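/- **Setting.** Let $X$ be a set with at least two points. A quasi-metric on $X$ is a function $\rho:X\times X\to[0,\infty)$ with $\rho(x,y)=0\iff x=y$ for which there are constants $C_0,C_1>0$ with $\rho(y,x)\le C_0\,\rho(x,y)$ and $\rho(x,y)\le C_1\max\{\rho(x,z),\rho(z,y)\}$ for all $x,y,z\in X$. Write $B_\rho(x,r)=\{y:\rho(x,y)<r\}$ and, for $B=B_\rho(x,r)$, $\sigma B=B_\rho(x,\sigma r)$. Let $$C_\rho:=\sup_{x,y,z\in X\text{ not all equal}}\frac{\rho(x,y)}{\max\{\rho(x,z),\rho(z,y)\}}\in[1,\infty),\qquad \mathrm{ind}(X,\rho):=\sup_{\varrho\approx\rho}\,(\log_2C_\varrho)^{-1}\in(0,\infty],$$ where the last supremum is over all quasi-metrics $\varrho$ on $X$ with $c^{-1}\varrho\le\rho\le c\,\varrho$ for some $c>0$, and $0^{-1}:=\infty$. For $s\in(0,\infty)$ and $q\in(0,\infty]$, $s\preceq_q\mathrm{ind}(X,\rho)$ means that $s\le\mathrm{ind}(X,\rho)$ and that $s=\mathrm{ind}(X,\rho)$ is allowed only if $q=\infty$ and the supremum defining $\mathrm{ind}(X,\rho)$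 is attained. $(X,\rho)$ is uniformly perfect if there is $\lambda\in(0,1)$ such that, for all $x\in X$ and $r>0$, $B_\rho(x,r)\setminus B_\rho(x,\lambda r)\ne\emptyset$ whenever $X\setminus B_\rho(x,r)\ne\emptyset$. $(X,\rho,\mu)$ is a quasi-metric measure space if $\mu$ is a Borel measure (for the topology generated by $\rho$) such that all balls $B_\rho(x,r)$ are $\mu$-measurable with $0<\mu(B_\rho(x,r))<\infty$. The measure $\mu$ is $Q$-doubling if there is $\kappa>0$ such that $\kappa(r/R)^Q\le\mu(B_\rho(x,r))/\mu(B_\rho(y,R))$ whenever $B_\rho(x,r)\subset B_\rho(y,R)$ and $0<r\le R<\infty$. **Function spaces.** For $A\subset X$ $\mu$-measurable and a $\mu$-measurable $u:A\to\mathbb R$, a fractional $s$-gradient of $u$ on $A$ is a sequence $(g_k)_{k\in\mathbb Z}$ of nonnegative $\mu$-measurable functions on $A$ such that, for some $\mu$-null set $E$, $|u(x)-u(y)|\le\rho(x,y)^s\,[g_k(x)+g_k(y)]$ for all $k\in\mathbb Z$ and all $x,y\in A\setminus E$ with $2^{-k-1}\le\rho(x,y)<2^{-k}$. For $p\in(0,\infty)$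 and $q\in(0,\infty]$, $\|u\|_{\dot M^s_{p,q}(A)}$ is the infimum of $\big\|\,\|(g_k)_k\|_{\ell^q}\big\|_{L^p(A,\mu)}$, and $\|u\|_{\dot N^s_{p,q}(A)}$ the infimum of $\big\|(\|g_k\|_{L^p(A,\mu)})_k\big\|_{\ell^q}$, over all fractional $s$-gradients of $u$ on $A$ ($\inf\emptyset=\infty$); $\dot M^s_{p,q}(A)$ and $\dot N^s_{p,q}(A)$ consist of the $\mu$-measurable $u:A\to\mathbb R$ for which the respective quantity is finite. **Theorem.** Let $(X,\rho,\mu)$ be a uniformly perfect quasi-metric measure space, $q\in(0,\infty]$, $Q\in(0,\infty)$, $\sigma\in[C_\rho,\infty)$, and let $s\in(0,\infty)$ satisfy $s\preceq_q\mathrm{ind}(X,\rho)$. Then the following are equivalent. (a) $\mu$ is $Q$-doubling. (b) There are $p\in(0,Q/s)$ and $C_S\in(0,\infty)$ such that, for every ball $B=B_\rho(x,r)$ with $x\in X$, $r\in(0,\infty)$, and every $u\in\dot M^s_{p,q}(\sigma B)$, with $p^*:=Qp/(Q-sp)$, $$\|u\|_{L^{p^*}(B)}\le\frac{C_S}{\mu(\sigma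 B)^{s/Q}}\Big[r^s\|u\|_{\dot M^s_{p,q}(\sigma B)}+\|u\|_{L^p(\sigma B)}\Big].$$ (c) There are $p\in(0,Q/s)$ and $C_P\in(0,\infty)$ such that, for every ball $B=B_\rho(x,r)$ with $x\in X$, $r\in(0,\infty)$, and every $u\in\dot M^s_{p,q}(\sigma B)$, with $p^*:=Qp/(Q-sp)$, $$\inf_{\gamma\in\mathbb R}\|u-\gamma\|_{L^{p^*}(B)}\le\frac{C_P}{\mu(\sigma B)^{s/Q}}\,r^s\|u\|_{\dot M^s_{p,q}(\sigma B)}.$$ (d) There are $p\in(Q/s,\infty)$ and $C_H\in(0,\infty)$ such that, for every ball $B=B_\rho(x,r)$ with $x\in X$, $r\in(0,\infty)$, every $u\in\dot M^s_{p,q}(\sigma B)$ agrees $\mu$-a.e. on $B$ with a function, again denoted $u$, that is Hölder continuous of order $s-Q/p$ on $B$ and satisfies $$|u(y)-u(z)|\le C_H\,\rho(y,z)^{s-Q/p}\,\frac{r^{Q/p}}{\mu(\sigma B)^{1/p}}\,\|u\|_{\dot M^s_{p,q}(\sigma B)}\qquad\text{for all }y,z\in B.$$ In addition, the same holds with $\dot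 M^s_{p,q}$ replaced by $\dot N^s_{p,q}$ if the exponents $p$ are subject to $q\le p$, whenever such exponents exist: if $q<Q/s$, then (a) and the $\dot N^s_{p,q}$-versions of (b), (c), (d), with the additional requirement $q\le p$ on the exponent $p$ in each of them, are equivalent; and for every $q<\infty$, (a) is equivalent to the $\dot N^s_{p,q}$-version of (d) with the additional requirement $q\le p$. -/

import Mathlib

open MeasureTheory Set
open scoped ENNReal NNReal

namespace QuasiMetricSobolev

noncomputable section

/-- `ρ` is a quasi-metric on `X` (not assumed symmetric). -/
structure IsQuasiMetric {X : Type*} (ρ : X → X → ℝ) : Prop where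
  nonneg : ∀ x y, 0 ≤ ρ x y
  eq_zero_iff : ∀ x y, ρ x y = 0 ↔ x = y
  quasi_symm : ∃ C₀ : ℝ, 0 < C₀ ∧ ∀ x y, ρ y x ≤ C₀ * ρ x y
  quasi_triangle : ∃ C₁ : ℝ, 0 < C₁ ∧ ∀ x y z, ρ x y ≤ C₁ * max (ρ x z) (ρ z y)

/-- The ball `B_ρ(x, r)`. -/
def qball {X : Type*} (ρ : X → X → ℝ) (x : X) (r : ℝ) : Set X := {y | ρ x y < r}

/-- The constant `C_ρ`: the supremum of `ρ(x,y) / max {ρ(x,z), ρ(z,y)}` over all points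
`x, y, z` which are not all equal. For a quasi-metric on a set with at least two points these
quotients form a nonempty bounded set of reals with positive denominators. -/
def triConst {X : Type*} (ρ : X → X → ℝ) : ℝ :=
  sSup {c : ℝ | ∃ x y z : X, ¬ (x = y ∧ y = z) ∧ c = ρ x y / max (ρ x z) (ρ z y)}

/-- (Bi-Lipschitz) equivalence `ρ ≈ ρ'`. -/
def QEquiv {X : Type*} (ρ ρ' : X → X → ℝ) : Prop :=
  ∃ c : ℝ, 0 < c ∧ ∀ x y, c⁻¹ * ρ' x y ≤ ρ x y ∧ ρ x y ≤ c * ρ' x y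

/-- `(log₂ C_ρ)⁻¹`, with value `∞` when `C_ρ = 1`. -/
def smoothExp {X : Type*} (ρ : X → X → ℝ) : ℝ≥0∞ :=
  (ENNReal.ofReal (Real.logb 2 (triConst ρ)))⁻¹

/-- The lower smoothness index `ind (X, ρ)`. -/
def lowerIndex {X : Type*} (ρ : X → X → ℝ) : ℝ≥0∞ :=
  ⨆ (ρ' : X → X → ℝ) (_ : IsQuasiMetric ρ' ∧ QEquiv ρ ρ'), smoothExp ρ'

/-- `s ⪯_q ind (X, ρ)`: `s ≤ ind (X, ρ)`, and equality is permitted only if `q = ∞` and the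
supremum defining the index is attained. -/
def IndexLE {X : Type*} (ρ : X → X → ℝ) (s : ℝ) (q : ℝ≥0∞) : Prop :=
  ENNReal.ofReal s ≤ lowerIndex ρ ∧
    (ENNReal.ofReal s = lowerIndex ρ →
      q = ∞ ∧ ∃ ρ' : X → X → ℝ, (IsQuasiMetric ρ' ∧ QEquiv ρ ρ') ∧ smoothExp ρ' = lowerIndex ρ)

/-- `(X, ρ)` is uniformly perfect. -/
def IsUniformlyPerfect {X : Type*} (ρ : X → X → ℝ) : Prop :=
  ∃ l : ℝ, 0 < l ∧ l < 1 ∧ ∀ (x : X) (r : ℝ), 0 < r →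
    (univ \ qball ρ x r).Nonempty → (qball ρ x r \ qball ρ x (l * r)).Nonempty

/-- `(X, ρ, μ)` is a quasi-metric measure space: `ρ` is a quasi-metric, `μ` is a Borel measure
(every set which is open in the topology generated by `ρ` is measurable), and all balls are
`μ`-measurable with positive finite measure. -/
structure IsQuasiMetricMeasure {X : Type*} [MeasurableSpace X] (ρ : X → X → ℝ)
    (μ : Measure X) : Prop where
  quasiMetric : IsQuasiMetric ρ
  measurableSet_of_open : ∀ U : Set X,
    (∀ x ∈ U, ∃ r : ℝ, 0 < r ∧ qball ρ x r ⊆ U) → MeasurableSet U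
  nullMeasurableSet_ball : ∀ (x : X) (r : ℝ), 0 < r → NullMeasurableSet (qball ρ x r) μ
  ball_pos : ∀ (x : X) (r : ℝ), 0 < r → 0 < μ (qball ρ x r)
  ball_lt_top : ∀ (x : X) (r : ℝ), 0 < r → μ (qball ρ x r) < ∞

/-- `μ` is `Q`-doubling. -/
def IsQDoubling {X : Type*} [MeasurableSpace X] (ρ : X → X → ℝ) (μ : Measure X) (Q : ℝ) : Prop :=
  ∃ κ : ℝ, 0 < κ ∧ ∀ (x y : X) (r R : ℝ), 0 < r → r ≤ R → qball ρ x r ⊆ qball ρ y R →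
    ENNReal.ofReal (κ * (r / R) ^ Q) ≤ μ (qball ρ x r) / μ (qball ρ y R)

/-- The sequence `g` is a fractional `s`-gradient on `(A, ρ, μ)` of the restriction of `u` to `A`.
Only the values of `u` and `g` on `A` matter. -/
def IsFracGradient {X : Type*} [MeasurableSpace X] (ρ : X → X → ℝ) (μ : Measure X) (s : ℝ)
    (A : Set X) (u : X → ℝ) (g : ℤ → X → ℝ≥0) : Prop :=
  (∀ k, AEMeasurable (g k) (μ.restrict A)) ∧
    ∃ E : Set X, μ E = 0 ∧ ∀ k : ℤ, ∀ x ∈ A \ E, ∀ y ∈ A \ E,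
      (2 : ℝ) ^ (-k - 1) ≤ ρ x y → ρ x y < (2 : ℝ) ^ (-k) →
        |u x - u y| ≤ ρ x y ^ s * ((g k x : ℝ) + (g k y : ℝ))

/-- The `ℓ^q` (quasi-)norm of a sequence indexed by `ℤ`, for `0 < q ≤ ∞`. -/
def seqNorm (q : ℝ≥0∞) (a : ℤ → ℝ≥0∞) : ℝ≥0∞ :=
  if q = ∞ then ⨆ k, a k else (∑' k, a k ^ q.toReal) ^ (1 / q.toReal)

/-- The `L^p(A, μ)` (quasi-)norm of a nonnegative function, for `0 < p < ∞`. -/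
def intNorm {X : Type*} [MeasurableSpace X] (μ : Measure X) (p : ℝ) (A : Set X)
    (f : X → ℝ≥0∞) : ℝ≥0∞ :=
  (∫⁻ x in A, f x ^ p ∂μ) ^ (1 / p)

/-- The homogeneous Hajłasz–Triebel–Lizorkin functional `‖u‖` of `Ṁ^s_{p,q}(A, ρ, μ)`, equal to
`∞` if `u` has no fractional `s`-gradient of finite norm. -/
def normM {X : Type*} [MeasurableSpace X] (ρ : X → X → ℝ) (μ : Measure X) (s p : ℝ) (q : ℝ≥0∞)
    (A : Set X) (u : X → ℝ) : ℝ≥0∞ :=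
  ⨅ (g : ℤ → X → ℝ≥0) (_ : IsFracGradient ρ μ s A u g),
    intNorm μ p A (fun x => seqNorm q (fun k => (g k x : ℝ≥0∞)))

/-- The homogeneous Hajłasz–Besov functional `‖u‖` of `Ṅ^s_{p,q}(A, ρ, μ)`, equal to
`∞` if `u` has no fractional `s`-gradient of finite norm. -/
def normN {X : Type*} [MeasurableSpace X] (ρ : X → X → ℝ) (μ : Measure X) (s p : ℝ) (q : ℝ≥0∞)
    (A : Set X) (u : X → ℝ) : ℝ≥0∞ :=
  ⨅ (g : ℤ → X → ℝ≥0) (_ : IsFracGradient ρ μ s A u g),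
    seqNorm q (fun k => intNorm μ p A (fun x => (g k x : ℝ≥0∞)))

/-- `u`, restricted to `A`, belongs to the homogeneous space on `A` with functional `F`: it is
`μ`-measurable on `A` and its functional on `A` is finite. -/
def MemHom {X : Type*} [MeasurableSpace X] (μ : Measure X) (F : Set X → (X → ℝ) → ℝ≥0∞)
    (A : Set X) (u : X → ℝ) : Prop :=
  AEMeasurable u (μ.restrict A) ∧ F A u < ∞

/-- The local Sobolev inequality on all balls, for the space with functional `F`; here
`p* = Q p / (Q - s p)`. -/
def LocalSobolev {X : Type*} [MeasurableSpace X] (ρ : X → X → ℝ) (μ : Measure X)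
    (F : Set X → (X → ℝ) → ℝ≥0∞) (Q s σ p : ℝ) : Prop :=
  ∃ C : ℝ, 0 < C ∧ ∀ (x : X) (r : ℝ), 0 < r →
    ∀ u : X → ℝ, MemHom μ F (qball ρ x (σ * r)) u →
      eLpNorm u (ENNReal.ofReal (Q * p / (Q - s * p))) (μ.restrict (qball ρ x r)) ≤
        ENNReal.ofReal C / μ (qball ρ x (σ * r)) ^ (s / Q) *
          (ENNReal.ofReal (r ^ s) * F (qball ρ x (σ * r)) u +
            eLpNorm u (ENNReal.ofReal p) (μ.restrict (qball ρ x (σ * r))))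

/-- The local Sobolev–Poincaré inequality on all balls, for the space with functional `F`; here
`p* = Q p / (Q - s p)`. -/
def LocalSobolevPoincare {X : Type*} [MeasurableSpace X] (ρ : X → X → ℝ) (μ : Measure X)
    (F : Set X → (X → ℝ) → ℝ≥0∞) (Q s σ p : ℝ) : Prop :=
  ∃ C : ℝ, 0 < C ∧ ∀ (x : X) (r : ℝ), 0 < r →
    ∀ u : X → ℝ, MemHom μ F (qball ρ x (σ * r)) u →
      (⨅ γ : ℝ, eLpNorm (fun y => u y - γ) (ENNReal.ofReal (Q * p / (Q - s * p)))
          (μ.restrict (qball ρ x r))) ≤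
        ENNReal.ofReal C / μ (qball ρ x (σ * r)) ^ (s / Q) *
          (ENNReal.ofReal (r ^ s) * F (qball ρ x (σ * r)) u)

/-- The local Hölder estimate on all balls, for the space with functional `F`: every member `u` of
the space on `σB` agrees `μ`-a.e. on `B` with a function `v` which satisfies the estimate at all
pairs of points of `B` (in particular, `v` is Hölder continuous of order `s - Q / p` on `B`). -/
def LocalHolder {X : Type*} [MeasurableSpace X] (ρ : X → X → ℝ) (μ : Measure X)
    (F : Set X → (X → ℝ) → ℝ≥0∞) (Q s σ p : ℝ) : Prop :=
  ∃ C : ℝ, 0 < C ∧ ∀ (x : X) (r : ℝ), 0 < r →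
    ∀ u : X → ℝ, MemHom μ F (qball ρ x (σ * r)) u →
      ∃ v : X → ℝ, v =ᵐ[μ.restrict (qball ρ x r)] u ∧
        ∀ y ∈ qball ρ x r, ∀ z ∈ qball ρ x r,
          |v y - v z| ≤ C * ρ y z ^ (s - Q / p) *
            (r ^ (Q / p) / (μ (qball ρ x (σ * r))).toReal ^ (1 / p)) *
              (F (qball ρ x (σ * r)) u).toReal

end

end QuasiMetricSobolev

/-!
Doubling implies the embeddings. A fractional gradient `(g_k)` in one of the spaces considered (with
`q ≤ p` in the Besov case) can be replaced by the single Hajłasz gradient `g = sup_k g_k` in `L^p`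
(`DominatesHajlasz`). If `μ` is `Q`-doubling then, by Chebyshev's inequality, every ball `B(y, t)`
with `y ∈ B` and `t ≤ r` contains points at which `g` is at most a constant times
`‖g‖_p μ(σB)^{-1/p} (r/t)^{Q/p}` (`HasGoodPoints`). Telescoping `u` along such points in the balls
`B(y, 2^{-j} r)`, all of them centred at `y` and hence contained in `σB`, gives a geometric series
with ratio `2^{Q/p-s}`. For `p > Q/s` it converges, and its limit is the Hölder continuous
representative (`HasGoodPoints.exists_holder`). For `p < Q/s` it is stopped at the optimal scale,
which bounds the oscillation of `u` at `y` by a constant times `g(y)^{1-sp/Q}` plus lower order terms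
(`HasGoodPoints.exists_hedberg`). Since `p* (1 - sp/Q) = p`, integration of the power `p*` of this
bound gives both inequalities of Sobolev type (`exists_sobolev_core`).

The embeddings imply doubling. The hypothesis on `s` and the index provides an order `β ≥ s`, with
`β > s` unless `q = ∞`, and a quasi-metric `ρ'` equivalent to `ρ` with `C_{ρ'}^β ≤ 2`. By Frink's
chain inequality (`frink_chain`) there are `β`-Hölder continuous functions comparable
to `ρ(x, ·)^β` (`HasRegularDistances`). Truncations of these are bump functions, and the functional
of a bump function with Hölder constant `L` supported in `U` is at most a multiple of
`L^{s/β} μ(U)^{1/p}` (`BumpBound`). Inserting bump functions on a decreasing sequence of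
neighbourhoods of `x` in a Sobolev inequality gives a superlinear recursion for their measures; as
these do not tend to zero, the first of them cannot be small (`isQDoubling_of_bump_inequality`). In
the Poincaré inequality the constant is harmless unless the neighbourhood already has half of the
measure of the ball, when there is nothing to show. In the Hölder estimate a single bump function
suffices, compared at a point near `x` and at a point, provided by uniform perfectness, where it
vanishes (`isQDoubling_of_localHolder`).
-/

namespace QuasiMetricSobolev

/-! ### Quasi-metrics and regularized distance functions -/

theorem qball_subset_qball {X : Type*} (ρ : X → X → ℝ) (x : X) {r R : ℝ} (h : r ≤ R) :
    qball ρ x r ⊆ qball ρ x R :=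
  fun _ hy => lt_of_lt_of_le hy h

theorem IsQuasiMetric.pos {X : Type*} {ρ : X → X → ℝ} (h : IsQuasiMetric ρ) {x y : X}
    (hxy : x ≠ y) : 0 < ρ x y :=
  lt_of_le_of_ne (h.nonneg x y) fun h0 => hxy ((h.eq_zero_iff x y).1 h0.symm)

theorem IsQuasiMetric.self {X : Type*} {ρ : X → X → ℝ} (h : IsQuasiMetric ρ) (x : X) :
    ρ x x = 0 :=
  (h.eq_zero_iff x x).2 rfl

/-- The quotients whose supremum is `triConst ρ` are bounded above, so that the real-valued
supremum is a genuine one. -/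
theorem IsQuasiMetric.bddAbove_triConst {X : Type*} {ρ : X → X → ℝ} (h : IsQuasiMetric ρ) :
    BddAbove {c : ℝ | ∃ x y z : X, ¬ (x = y ∧ y = z) ∧
      c = ρ x y / max (ρ x z) (ρ z y)} := by
  obtain ⟨C, hC, hC'⟩ := h.quasi_triangle
  refine ⟨C, ?_⟩
  rintro c ⟨x, y, z, -, rfl⟩
  exact div_le_of_le_mul₀ (le_max_of_le_left (h.nonneg _ _)) hC.le (hC' x y z)

theorem IsQuasiMetric.le_triConst_mul {X : Type*} {ρ : X → X → ℝ} (h : IsQuasiMetric ρ)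
    (x y z : X) : ρ x y ≤ triConst ρ * max (ρ x z) (ρ z y) := by
  by_cases hxyz : x = y ∧ y = z
  · obtain ⟨rfl, rfl⟩ := hxyz
    simp [h.self]
  · have hpos : 0 < max (ρ x z) (ρ z y) := by
      by_cases hxz : x = z
      · subst hxz
        exact lt_max_of_lt_right (h.pos fun hh => hxyz ⟨hh, hh.symm⟩)
      · exact lt_max_of_lt_left (h.pos hxz)
    rw [← div_le_iff₀ hpos]
    exact le_csSup h.bddAbove_triConst ⟨x, y, z, hxyz, rfl⟩

theorem IsQuasiMetric.one_le_triConst {X : Type*} [Nontrivial X] {ρ : X → X → ℝ}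
    (h : IsQuasiMetric ρ) : 1 ≤ triConst ρ := by
  obtain ⟨x, y, hxy⟩ := exists_pair_ne X
  have := h.le_triConst_mul x y y
  rw [h.self, max_eq_left (h.nonneg _ _)] at this
  have hp := h.pos hxy
  by_contra! hlt
  nlinarith

/-- One constant serving for quasi-symmetry and for the quasi-triangle inequality. -/
theorem IsQuasiMetric.exists_const {X : Type*} {ρ : X → X → ℝ} (h : IsQuasiMetric ρ) :
    ∃ K : ℝ, 1 ≤ K ∧ (∀ x y, ρ y x ≤ K * ρ x y) ∧
      ∀ x y z, ρ x y ≤ K * max (ρ x z) (ρ z y) := by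
  obtain ⟨C₀, -, h₀⟩ := h.quasi_symm
  obtain ⟨C₁, -, h₁⟩ := h.quasi_triangle
  refine ⟨max 1 (max C₀ C₁), le_max_left _ _, fun x y => (h₀ x y).trans ?_,
    fun x y z => (h₁ x y z).trans ?_⟩
  · exact mul_le_mul_of_nonneg_right (by simp) (h.nonneg _ _)
  · exact mul_le_mul_of_nonneg_right (by simp) (le_max_of_le_left (h.nonneg _ _))

/-- Frink's chain inequality: if `D` satisfies the quasi-triangle inequality with constant `2`,
the value of `D` at the end points of a chain is controlled by the sum of `D` over its links, where
inner links are counted with weight `4` and the two outer ones with weight `2`. This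
distribution of the weights makes the induction close: two subchains which overlap in one link are
glued along a link that is an outer one for both. -/
theorem frink_chain {X : Type*} {D : X → X → ℝ} (h0 : ∀ x y, 0 ≤ D x y)
    (hD : ∀ x y z, D x y ≤ 2 * max (D x z) (D z y)) (f : ℕ → X) {S : ℕ → ℝ}
    (hS : ∀ i, S (i + 1) = S i + D (f i) (f (i + 1))) (n : ℕ) :
    ∀ a b : ℕ, a + 1 ≤ b → b + 1 ≤ a + n →
      D (f a) (f (b + 1)) ≤
        2 * (2 * (S (b + 1) - S a) - D (f a) (f (a + 1)) - D (f b) (f (b + 1))) := by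
  have hmono : Monotone S := monotone_nat_of_le_succ fun i => by
    rw [hS]; linarith [h0 (f i) (f (i + 1))]
  induction n with
  | zero => intro a b h1 h2; omega
  | succ n ih =>
    intro a b hab hbn
    have hSa := hS a
    have hSb := hS b
    have hm := hmono hab
    have hDa := h0 (f a) (f (a + 1))
    have hDb := h0 (f b) (f (b + 1))
    -- the last vertex `p` for which the tail `f p, …, f (b + 1)` still carries half of `D`
    obtain ⟨p, ⟨hap, hpb, hp⟩, hmax⟩ : ∃ p, (a ≤ p ∧ p ≤ b ∧
        D (f a) (f (b + 1)) ≤ 2 * D (f p) (f (b + 1))) ∧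
        ∀ p', (a ≤ p' ∧ p' ≤ b ∧ D (f a) (f (b + 1)) ≤ 2 * D (f p') (f (b + 1))) → p' ≤ p := by
      classical
      let P : ℕ → Prop := fun p => a ≤ p ∧ p ≤ b ∧ D (f a) (f (b + 1)) ≤ 2 * D (f p) (f (b + 1))
      have hPa : P a := ⟨le_rfl, by omega, by linarith [h0 (f a) (f (b + 1))]⟩
      exact ⟨Nat.findGreatest P b, Nat.findGreatest_spec (by omega : a ≤ b) hPa,
        fun p' hp' => Nat.le_findGreatest hp'.2.1 hp'⟩
    rcases hpb.eq_or_lt with rfl | hpb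
    · linarith
    · have hnext : D (f a) (f (b + 1)) ≤ 2 * D (f a) (f (p + 1)) := by
        rcases le_max_iff.1 ((div_le_iff₀' (by norm_num : (0 : ℝ) < 2)).2
          (hD (f a) (f (b + 1)) (f (p + 1)))) with h | h
        · linarith
        · have := hmax (p + 1) ⟨by omega, by omega, by linarith⟩
          omega
      rcases hap.eq_or_lt with rfl | hap
      · linarith
      · have h1 := ih a p (by omega) (by omega)
        have h2 := ih p b (by omega) (by omega)
        have hSp := hS p
        linarith

/-- The distance to `x` obtained by minimizing over chains. It is `1`-Lipschitz with respect
to `D` and, by Frink's inequality, comparable to `D x`. -/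
theorem exists_chain_distance {X : Type*} {D : X → X → ℝ} (h0 : ∀ x y, 0 ≤ D x y)
    (hself : ∀ x, D x x = 0) (hsymm : ∀ x y, D x y = D y x)
    (hD : ∀ x y z, D x y ≤ 2 * max (D x z) (D z y)) (x : X) :
    ∃ δ : X → ℝ, (∀ y, D x y ≤ 4 * δ y) ∧ (∀ y, δ y ≤ D x y) ∧
      ∀ y z, |δ y - δ z| ≤ D y z := by
  let A : X → Set ℝ := fun y => {c | ∃ (n : ℕ) (f : ℕ → X), f 0 = x ∧ f n = y ∧
    c = ∑ i ∈ Finset.range n, D (f i) (f (i + 1))}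
  have hlow : ∀ y, ∀ c ∈ A y, D x y ≤ 4 * c := by
    rintro y c ⟨n, f, rfl, rfl, rfl⟩
    match n with
    | 0 => simp [hself]
    | 1 => simpa using by linarith [h0 (f 0) (f 1)]
    | n + 2 =>
      have := frink_chain h0 hD f (S := fun n => ∑ i ∈ Finset.range n, D (f i) (f (i + 1)))
        (fun i => Finset.sum_range_succ _ _) (n + 2) 0 (n + 1) (by omega) (by omega)
      simp only [Finset.range_zero, Finset.sum_empty] at this
      linarith [h0 (f 0) (f (0 + 1)), h0 (f (n + 1)) (f (n + 1 + 1))]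
  have hbdd : ∀ y, BddBelow (A y) := fun y => ⟨0, fun c hc => by
    linarith [hlow y c hc, h0 x y]⟩
  have hmem : ∀ y, D x y ∈ A y := fun y =>
    ⟨1, fun i => if i = 0 then x else y, by simp, by simp, by simp⟩
  have hlip : ∀ y z, sInf (A z) ≤ sInf (A y) + D y z := by
    intro y z
    rw [← sub_le_iff_le_add]
    refine le_csInf ⟨_, hmem y⟩ ?_
    rintro c ⟨n, f, h1, h2, rfl⟩
    rw [sub_le_iff_le_add]
    refine csInf_le (hbdd z) ⟨n + 1, fun i => if i ≤ n then f i else z, by simpa using h1,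
      by simp, ?_⟩
    rw [Finset.sum_range_succ]
    congr 1
    · refine Finset.sum_congr rfl fun i hi => ?_
      have := Finset.mem_range.1 hi
      simp only [if_pos (show i ≤ n by omega), if_pos (show i + 1 ≤ n by omega)]
    · simp [h2]
  refine ⟨fun y => sInf (A y), fun y => ?_, fun y => csInf_le (hbdd y) (hmem y), fun y z => ?_⟩
  · have : D x y / 4 ≤ sInf (A y) := le_csInf ⟨_, hmem y⟩ fun c hc => by linarith [hlow y c hc]
    linarith
  · rw [abs_le]
    constructor
    · linarith [hlip y z]
    · linarith [hlip z y, hsymm y z]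

/-- `β` is an admissible order of smoothness on `(X, ρ)`: up to constants, `ρ(x, ·)^β` is a
function which is Hölder continuous of order `β`, uniformly in `x`. -/
def HasRegularDistances {X : Type*} (ρ : X → X → ℝ) (β : ℝ) : Prop :=
  ∃ c : ℝ, 1 ≤ c ∧ ∀ x : X, ∃ δ : X → ℝ,
    (∀ y, ρ x y ^ β ≤ c * δ y) ∧ (∀ y, δ y ≤ c * ρ x y ^ β) ∧ ∀ y z, |δ y - δ z| ≤ c * ρ y z ^ β

theorem hasRegularDistances_of_triConst {X : Type*} [Nontrivial X] {ρ ρ' : X → X → ℝ}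
    (h : IsQuasiMetric ρ) (h' : IsQuasiMetric ρ') (he : QEquiv ρ ρ') {β : ℝ} (hβ : 0 < β)
    (hC : triConst ρ' ^ β ≤ 2) : HasRegularDistances ρ β := by
  obtain ⟨c, hc, hcρ⟩ := he
  obtain ⟨K, hK, hKs, -⟩ := h'.exists_const
  -- symmetrizing by the maximum does not increase the quasi-triangle constant
  let D : X → X → ℝ := fun x y => max (ρ' x y) (ρ' y x) ^ β
  have hm0 : ∀ x y, 0 ≤ max (ρ' x y) (ρ' y x) := fun x y => le_max_of_le_left (h'.nonneg _ _)
  have hD0 : ∀ x y, 0 ≤ D x y := fun x y => Real.rpow_nonneg (hm0 x y) _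
  have hT := h'.one_le_triConst
  have hDtri : ∀ x y z, D x y ≤ 2 * max (D x z) (D z y) := by
    intro x y z
    have h1 : max (ρ' x y) (ρ' y x) ≤ triConst ρ' *
        max (max (ρ' x z) (ρ' z x)) (max (ρ' z y) (ρ' y z)) := by
      refine max_le ((h'.le_triConst_mul x y z).trans ?_) ((h'.le_triConst_mul y x z).trans ?_)
      · gcongr <;> exact le_max_left _ _
      · rw [max_comm (ρ' y z)]
        gcongr <;> exact le_max_right _ _
    have h2 : max (max (ρ' x z) (ρ' z x)) (max (ρ' z y) (ρ' y z)) ^ β ≤ max (D x z) (D z y) := by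
      rcases max_choice (max (ρ' x z) (ρ' z x)) (max (ρ' z y) (ρ' y z)) with h | h <;> rw [h]
      · exact le_max_left _ _
      · exact le_max_right _ _
    calc D x y ≤ (triConst ρ' * max (max (ρ' x z) (ρ' z x)) (max (ρ' z y) (ρ' y z))) ^ β :=
          Real.rpow_le_rpow (hm0 _ _) h1 hβ.le
      _ = triConst ρ' ^ β * max (max (ρ' x z) (ρ' z x)) (max (ρ' z y) (ρ' y z)) ^ β :=
          Real.mul_rpow (by linarith) (le_max_of_le_left (hm0 _ _))
      _ ≤ 2 * max (D x z) (D z y) := by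
          gcongr
          exact Real.rpow_nonneg (le_max_of_le_left (hm0 _ _)) _
  have hup : ∀ x y, D x y ≤ (K * c) ^ β * ρ x y ^ β := by
    intro x y
    rw [← Real.mul_rpow (by positivity) (h.nonneg _ _)]
    refine Real.rpow_le_rpow (hm0 _ _) ?_ hβ.le
    have h1 : ρ' x y ≤ c * ρ x y := by
      have := (hcρ x y).1
      rwa [inv_mul_le_iff₀ hc] at this
    have h2 : max (ρ' x y) (ρ' y x) ≤ K * ρ' x y :=
      max_le (le_mul_of_one_le_left (h'.nonneg _ _) hK) (hKs x y)
    calc _ ≤ K * ρ' x y := h2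
      _ ≤ K * (c * ρ x y) := by gcongr
      _ = _ := by ring
  have hlo : ∀ x y, ρ x y ^ β ≤ c ^ β * D x y := by
    intro x y
    rw [← Real.mul_rpow hc.le (hm0 _ _)]
    refine Real.rpow_le_rpow (h.nonneg _ _) ((hcρ x y).2.trans ?_) hβ.le
    gcongr
    exact le_max_left _ _
  refine ⟨max 1 (max ((K * c) ^ β) (4 * c ^ β)), le_max_left _ _, fun x => ?_⟩
  obtain ⟨δ, hδ1, hδ2, hδ3⟩ := exists_chain_distance hD0
    (fun x => by simp [D, h'.self, hβ.ne']) (fun x y => by simp only [D, max_comm]) hDtri x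
  have hM1 : (K * c) ^ β ≤ max 1 (max ((K * c) ^ β) (4 * c ^ β)) := by simp
  have hM2 : 4 * c ^ β ≤ max 1 (max ((K * c) ^ β) (4 * c ^ β)) := by simp
  refine ⟨δ, fun y => ?_, fun y => ?_, fun y z => ?_⟩
  · have hδ0 : 0 ≤ δ y := by linarith [hδ1 y, hD0 x y]
    calc _ ≤ c ^ β * D x y := hlo x y
      _ ≤ c ^ β * (4 * δ y) := by gcongr; exact hδ1 y
      _ = (4 * c ^ β) * δ y := by ring
      _ ≤ _ := by gcongr
  · refine (hδ2 y).trans ((hup x y).trans ?_)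
    gcongr
    exact Real.rpow_nonneg (h.nonneg _ _) _
  · refine (hδ3 y z).trans ((hup y z).trans ?_)
    gcongr
    exact Real.rpow_nonneg (h.nonneg _ _) _

theorem triConst_rpow_le_two {X : Type*} [Nontrivial X] {ρ : X → X → ℝ} (h : IsQuasiMetric ρ)
    {β : ℝ} (hβ : 0 < β) (hle : ENNReal.ofReal β ≤ smoothExp ρ) : triConst ρ ^ β ≤ 2 := by
  have hT := h.one_le_triConst
  unfold smoothExp at hle
  rw [ENNReal.le_inv_iff_le_inv, ← ENNReal.ofReal_inv_of_pos hβ,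
    ENNReal.ofReal_le_ofReal_iff (by positivity)] at hle
  have h1 : triConst ρ ≤ 2 ^ β⁻¹ :=
    (Real.logb_le_iff_le_rpow (by norm_num) (by linarith)).1 hle
  calc triConst ρ ^ β ≤ (2 ^ β⁻¹ : ℝ) ^ β := Real.rpow_le_rpow (by linarith) h1 hβ.le
    _ = 2 := by rw [← Real.rpow_mul (by norm_num), inv_mul_cancel₀ hβ.ne', Real.rpow_one]

/-- The relation `s ⪯_q ind (X, ρ)` provides Hölder continuous functions of some order `β ≥ s`,
where `β > s` unless `q = ∞`. -/
theorem IndexLE.exists_hasRegularDistances {X : Type*} [Nontrivial X] {ρ : X → X → ℝ}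
    (h : IsQuasiMetric ρ) {s : ℝ} (hs : 0 < s) {q : ℝ≥0∞} (hind : IndexLE ρ s q) :
    ∃ β : ℝ, s ≤ β ∧ (q = ∞ ∨ s < β) ∧ HasRegularDistances ρ β := by
  rcases hind.1.eq_or_lt with heq | hlt
  · obtain ⟨hq, ρ', ⟨h', he⟩, hatt⟩ := hind.2 heq
    exact ⟨s, le_rfl, Or.inl hq, hasRegularDistances_of_triConst h h' he hs
      (triConst_rpow_le_two h' hs (by rw [hatt, heq]))⟩
  · obtain ⟨ρ', hlt⟩ := lt_iSup_iff.1 hlt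
    obtain ⟨⟨h', he⟩, hlt⟩ := lt_iSup_iff.1 hlt
    obtain ⟨b, hb1, hb2⟩ := exists_between hlt
    have hbt : b ≠ ∞ := (hb2.trans_le le_top).ne
    have hsb : s < b.toReal := (ENNReal.ofReal_lt_iff_lt_toReal hs.le hbt).1 hb1
    refine ⟨b.toReal, hsb.le, Or.inr hsb, hasRegularDistances_of_triConst h h' he (hs.trans hsb)
      (triConst_rpow_le_two h' (hs.trans hsb) ?_)⟩
    rw [ENNReal.ofReal_toReal hbt]
    exact hb2.le

/-! ### The sequence norms and the norms `intNorm` -/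

theorem seqNorm_mono {q : ℝ≥0∞} {a b : ℤ → ℝ≥0∞} (h : ∀ k, a k ≤ b k) :
    seqNorm q a ≤ seqNorm q b := by
  unfold seqNorm
  split_ifs
  · exact iSup_mono h
  · gcongr with k
    exact h k

theorem seqNorm_const_mul {q : ℝ≥0∞} (hq : 0 < q) (c : ℝ≥0∞) (a : ℤ → ℝ≥0∞) :
    seqNorm q (fun k => c * a k) = c * seqNorm q a := by
  unfold seqNorm
  split_ifs with h
  · rw [ENNReal.mul_iSup]
  · have hq' : 0 < q.toReal := ENNReal.toReal_pos hq.ne' h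
    simp_rw [ENNReal.mul_rpow_of_nonneg _ _ hq'.le]
    rw [ENNReal.tsum_mul_left, ENNReal.mul_rpow_of_nonneg _ _ (by positivity), ← ENNReal.rpow_mul,
      mul_one_div_cancel hq'.ne', ENNReal.rpow_one]

theorem seqNorm_comp_sub (q : ℝ≥0∞) (a : ℤ → ℝ≥0∞) (m : ℤ) :
    seqNorm q (fun k => a (k - m)) = seqNorm q a := by
  unfold seqNorm
  split_ifs
  · exact (Equiv.subRight m).iSup_comp (g := a)
  · rw [(Equiv.subRight m).tsum_eq (fun k => a k ^ q.toReal) |>.symm]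
    rfl

theorem le_seqNorm {q : ℝ≥0∞} (hq : 0 < q) (a : ℤ → ℝ≥0∞) (k : ℤ) : a k ≤ seqNorm q a := by
  unfold seqNorm
  split_ifs with h
  · exact le_iSup a k
  · have hq' : 0 < q.toReal := ENNReal.toReal_pos hq.ne' h
    calc a k = (a k ^ q.toReal) ^ (1 / q.toReal) := by
          rw [← ENNReal.rpow_mul, mul_one_div_cancel hq'.ne', ENNReal.rpow_one]
      _ ≤ _ := by
          gcongr
          exact ENNReal.le_tsum k

/-- The inclusion `ℓ^q ⊆ ℓ^p` for `q ≤ p`. -/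
theorem tsum_rpow_le_seqNorm_rpow {q : ℝ≥0∞} (hq : 0 < q) {p : ℝ} (hp : 0 < p)
    (hqp : q ≤ ENNReal.ofReal p) (a : ℤ → ℝ≥0∞) : ∑' k, a k ^ p ≤ seqNorm q a ^ p := by
  have hqt : q ≠ ∞ := (hqp.trans_lt ENNReal.ofReal_lt_top).ne
  have hq' : 0 < q.toReal := ENNReal.toReal_pos hq.ne' hqt
  have hqp' : q.toReal ≤ p := ENNReal.toReal_le_of_le_ofReal hp.le hqp
  have hS : ∑' k, a k ^ q.toReal = seqNorm q a ^ q.toReal := by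
    rw [seqNorm, if_neg hqt, ← ENNReal.rpow_mul, one_div_mul_cancel hq'.ne', ENNReal.rpow_one]
  calc ∑' k, a k ^ p = ∑' k, a k ^ q.toReal * a k ^ (p - q.toReal) := by
        refine tsum_congr fun k => ?_
        rw [← ENNReal.rpow_add_of_nonneg _ _ hq'.le (by linarith)]
        congr 1
        ring
    _ ≤ ∑' k, a k ^ q.toReal * seqNorm q a ^ (p - q.toReal) := by
        gcongr with k
        exact le_seqNorm hq a k
    _ = seqNorm q a ^ p := by
        rw [ENNReal.tsum_mul_right, hS, ← ENNReal.rpow_add_of_nonneg _ _ hq'.le (by linarith)]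
        congr 1
        ring

theorem seqNorm_geometric_lt_top {q : ℝ≥0∞} {ε : ℝ} (hε : 0 ≤ ε) (h : q = ∞ ∨ 0 < ε)
    (hq : 0 < q) :
    seqNorm q (fun m : ℤ => ENNReal.ofReal (2 ^ (-ε * |(m : ℝ)|))) < ∞ := by
  unfold seqNorm
  split_ifs with hqt
  · refine lt_of_le_of_lt (iSup_le fun m => ?_) ENNReal.one_lt_top
    rw [← ENNReal.ofReal_one]
    refine ENNReal.ofReal_le_ofReal (Real.rpow_le_one_of_one_le_of_nonpos (by norm_num) ?_)
    nlinarith [abs_nonneg (m : ℝ)]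
  · have hε' : 0 < ε := h.resolve_left hqt
    have hq' : 0 < q.toReal := ENNReal.toReal_pos hq.ne' hqt
    refine ENNReal.rpow_lt_top_of_nonneg (by positivity) ?_
    have hterm : ∀ m : ℤ, ENNReal.ofReal (2 ^ (-ε * |(m : ℝ)|)) ^ q.toReal =
        ENNReal.ofReal (((2 : ℝ) ^ (-ε * q.toReal)) ^ m.natAbs) := by
      intro m
      rw [ENNReal.ofReal_rpow_of_nonneg (by positivity) hq'.le, ← Real.rpow_natCast,
        ← Real.rpow_mul (by norm_num), ← Real.rpow_mul (by norm_num), Nat.cast_natAbs, Int.cast_abs]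
      congr 2
      ring
    have hr : (2 : ℝ) ^ (-ε * q.toReal) < 1 :=
      Real.rpow_lt_one_of_one_lt_of_neg (by norm_num) (by nlinarith)
    have hsum : Summable fun n : ℕ => ((2 : ℝ) ^ (-ε * q.toReal)) ^ n :=
      summable_geometric_of_lt_one (by positivity) hr
    have hsumZ : Summable fun m : ℤ => ((2 : ℝ) ^ (-ε * q.toReal)) ^ m.natAbs :=
      Summable.of_nat_of_neg (by simpa using hsum) (by simpa using hsum)
    simp_rw [hterm]
    exact hsumZ.tsum_ofReal_ne_top

theorem intNorm_const_mul {X : Type*} [MeasurableSpace X] (μ : Measure X) {p : ℝ} (hp : 0 < p)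
    (A : Set X) {c : ℝ≥0∞} (hc : c ≠ ∞) (f : X → ℝ≥0∞) :
    intNorm μ p A (fun x => c * f x) = c * intNorm μ p A f := by
  unfold intNorm
  simp_rw [ENNReal.mul_rpow_of_nonneg _ _ hp.le]
  rw [lintegral_const_mul' _ _ (ENNReal.rpow_ne_top_of_nonneg hp.le hc),
    ENNReal.mul_rpow_of_nonneg _ _ (by positivity), ← ENNReal.rpow_mul,
    mul_one_div_cancel hp.ne', ENNReal.rpow_one]

theorem intNorm_rpow {X : Type*} [MeasurableSpace X] (μ : Measure X) {p : ℝ} (hp : 0 < p)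
    (A : Set X) (f : X → ℝ≥0∞) : intNorm μ p A f ^ p = ∫⁻ x in A, f x ^ p ∂μ := by
  rw [intNorm, ← ENNReal.rpow_mul, one_div_mul_cancel hp.ne', ENNReal.rpow_one]

theorem intNorm_indicator_one_le {X : Type*} [MeasurableSpace X] (μ : Measure X) {p : ℝ}
    (hp : 0 < p) (A : Set X) {U : Set X} (hU : MeasurableSet U) :
    intNorm μ p A (U.indicator 1) ≤ μ U ^ (1 / p) := by
  unfold intNorm
  gcongr
  have : (fun x => (U.indicator 1 x : ℝ≥0∞) ^ p) = U.indicator 1 := by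
    ext x
    by_cases hx : x ∈ U <;> simp [hx, hp]
  rw [this, lintegral_indicator_one hU]
  exact Measure.restrict_apply_le _ _

/-! ### Hajłasz gradients -/

/-- A single function `g` controlling the differences of `u` at all scales: a Hajłasz
`s`-gradient of `u` on `A`. -/
def IsHajlaszGradient {X : Type*} [MeasurableSpace X] (ρ : X → X → ℝ) (μ : Measure X) (s : ℝ)
    (A : Set X) (u : X → ℝ) (g : X → ℝ≥0) : Prop :=
  AEMeasurable g (μ.restrict A) ∧
    ∃ E : Set X, μ E = 0 ∧ ∀ x ∈ A \ E, ∀ y ∈ A \ E,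
      |u x - u y| ≤ ρ x y ^ s * ((g x : ℝ) + (g y : ℝ))

/-- The functional `F` dominates the homogeneous Hajłasz–Sobolev functional of `Ṁ^{s,p}`. -/
def DominatesHajlasz {X : Type*} [MeasurableSpace X] (ρ : X → X → ℝ) (μ : Measure X) (s p : ℝ)
    (F : Set X → (X → ℝ) → ℝ≥0∞) : Prop :=
  ∀ A : Set X, NullMeasurableSet A μ → ∀ (u : X → ℝ) (N : ℝ≥0∞), F A u < N →
    ∃ g : X → ℝ≥0, IsHajlaszGradient ρ μ s A u g ∧ ∫⁻ x in A, (g x : ℝ≥0∞) ^ p ∂μ ≤ N ^ p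

theorem exists_zpow_scale {t : ℝ} (ht : 0 < t) :
    ∃ k : ℤ, (2 : ℝ) ^ (-k - 1) ≤ t ∧ t < (2 : ℝ) ^ (-k) := by
  obtain ⟨n, h1, h2⟩ := exists_mem_Ico_zpow ht (one_lt_two : (1 : ℝ) < 2)
  exact ⟨-(n + 1), by simpa using h1, by simpa using h2⟩

/-- The supremum over all scales of a fractional gradient is a Hajłasz gradient. -/
theorem IsFracGradient.exists_isHajlaszGradient {X : Type*} [MeasurableSpace X] {ρ : X → X → ℝ}
    {μ : Measure X} (hρ : IsQuasiMetric ρ) {s p : ℝ} (hp : 0 < p) {A : Set X}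
    (hA : NullMeasurableSet A μ) {u : X → ℝ} {g : ℤ → X → ℝ≥0} (hg : IsFracGradient ρ μ s A u g)
    (hfin : ∫⁻ x in A, (⨆ k, (g k x : ℝ≥0∞)) ^ p ∂μ < ∞) :
    ∃ G : X → ℝ≥0, IsHajlaszGradient ρ μ s A u G ∧
      ∫⁻ x in A, (G x : ℝ≥0∞) ^ p ∂μ ≤ ∫⁻ x in A, (⨆ k, (g k x : ℝ≥0∞)) ^ p ∂μ := by
  obtain ⟨hm, E, hE, hgE⟩ := hg
  have hsm : AEMeasurable (fun x => ⨆ k, (g k x : ℝ≥0∞)) (μ.restrict A) :=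
    AEMeasurable.iSup fun k => (hm k).coe_nnreal_ennreal
  refine ⟨fun x => (⨆ k, (g k x : ℝ≥0∞)).toNNReal, ⟨hsm.ennreal_toNNReal, ?_⟩, ?_⟩
  · have hae : ∀ᵐ x ∂μ.restrict A, (⨆ k, (g k x : ℝ≥0∞)) < ∞ := by
      filter_upwards [ae_lt_top' (hsm.pow_const p) hfin.ne] with x hx
      by_contra hcon
      rw [not_lt_top_iff.1 hcon, ENNReal.top_rpow_of_pos hp] at hx
      exact lt_irrefl _ hx
    rw [ae_restrict_iff'₀ hA] at hae
    refine ⟨E ∪ {x | ¬ (x ∈ A → (⨆ k, (g k x : ℝ≥0∞)) < ∞)}, measure_union_null hE hae, ?_⟩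
    rintro x ⟨hxA, hxE⟩ y ⟨hyA, hyE⟩
    simp only [mem_union, mem_ofPred_eq, not_or, not_not] at hxE hyE
    by_cases hxy : x = y
    · subst hxy
      simp only [sub_self, abs_zero]
      exact mul_nonneg (Real.rpow_nonneg (hρ.nonneg _ _) _) (by positivity)
    · obtain ⟨k, hk1, hk2⟩ := exists_zpow_scale (hρ.pos hxy)
      refine (hgE k x ⟨hxA, hxE.1⟩ y ⟨hyA, hyE.1⟩ hk1 hk2).trans ?_
      have hle : ∀ z, (⨆ k, (g k z : ℝ≥0∞)) < ∞ → g k z ≤ (⨆ k, (g k z : ℝ≥0∞)).toNNReal := by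
        intro z hz
        rw [← ENNReal.coe_le_coe, ENNReal.coe_toNNReal hz.ne]
        exact le_iSup (fun k => (g k z : ℝ≥0∞)) k
      have hx := hle x (hxE.2 hxA)
      have hy := hle y (hyE.2 hyA)
      have := Real.rpow_nonneg (hρ.nonneg x y) s
      gcongr
  · gcongr with x
    exact ENNReal.coe_toNNReal_le_self

theorem dominatesHajlasz_normM {X : Type*} [MeasurableSpace X] {ρ : X → X → ℝ}
    {μ : Measure X} (hρ : IsQuasiMetric ρ) {s p : ℝ} (hp : 0 < p) {q : ℝ≥0∞} (hq : 0 < q) :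
    DominatesHajlasz ρ μ s p (normM ρ μ s p q) := by
  intro A hA u N hN
  obtain ⟨g, hN⟩ := iInf_lt_iff.1 hN
  obtain ⟨hg, hN⟩ := iInf_lt_iff.1 hN
  have hle : ∫⁻ x in A, (⨆ k, (g k x : ℝ≥0∞)) ^ p ∂μ ≤
      intNorm μ p A (fun x => seqNorm q (fun k => (g k x : ℝ≥0∞))) ^ p := by
    rw [intNorm_rpow μ hp]
    gcongr with x
    exact iSup_le fun k => le_seqNorm hq (fun k => (g k x : ℝ≥0∞)) k
  obtain ⟨G, hG, hGN⟩ := hg.exists_isHajlaszGradient hρ hp hA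
    (hle.trans_lt (ENNReal.rpow_lt_top_of_nonneg hp.le (hN.trans_le le_top).ne))
  exact ⟨G, hG, hGN.trans (hle.trans (by gcongr))⟩

theorem dominatesHajlasz_normN {X : Type*} [MeasurableSpace X] {ρ : X → X → ℝ}
    {μ : Measure X} (hρ : IsQuasiMetric ρ) {s p : ℝ} (hp : 0 < p) {q : ℝ≥0∞} (hq : 0 < q)
    (hqp : q ≤ ENNReal.ofReal p) :
    DominatesHajlasz ρ μ s p (normN ρ μ s p q) := by
  intro A hA u N hN
  obtain ⟨g, hN⟩ := iInf_lt_iff.1 hN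
  obtain ⟨hg, hN⟩ := iInf_lt_iff.1 hN
  have hle : ∫⁻ x in A, (⨆ k, (g k x : ℝ≥0∞)) ^ p ∂μ ≤
      seqNorm q (fun k => intNorm μ p A (fun x => (g k x : ℝ≥0∞))) ^ p := by
    calc ∫⁻ x in A, (⨆ k, (g k x : ℝ≥0∞)) ^ p ∂μ
        ≤ ∫⁻ x in A, ∑' k, (g k x : ℝ≥0∞) ^ p ∂μ := by
          gcongr with x
          rw [← ENNReal.le_rpow_inv_iff hp]
          refine iSup_le fun k => ?_
          rw [ENNReal.le_rpow_inv_iff hp]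
          exact ENNReal.le_tsum k
      _ = ∑' k, intNorm μ p A (fun x => (g k x : ℝ≥0∞)) ^ p := by
          rw [lintegral_tsum fun k => ((hg.1 k).coe_nnreal_ennreal.pow_const p)]
          simp_rw [intNorm_rpow μ hp]
      _ ≤ _ := tsum_rpow_le_seqNorm_rpow hq hp hqp _
  obtain ⟨G, hG, hGN⟩ := hg.exists_isHajlaszGradient hρ hp hA
    (hle.trans_lt (ENNReal.rpow_lt_top_of_nonneg hp.le (hN.trans_le le_top).ne))
  exact ⟨G, hG, hGN.trans (hle.trans (by gcongr))⟩

/-! ### The functionals of bump functions -/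

/-- The functional `F` of a bump function which is supported in `U` and Hölder continuous of
order `β` with constant `L` is at most a multiple of `L^{s/β} μ(U)^{1/p}`. -/
def BumpBound {X : Type*} [MeasurableSpace X] (ρ : X → X → ℝ) (μ : Measure X) (s p β : ℝ)
    (F : Set X → (X → ℝ) → ℝ≥0∞) : Prop :=
  ∃ K : ℝ, 0 < K ∧ ∀ (A U : Set X) (u : X → ℝ) (L : ℝ), 0 < L → MeasurableSet U →
    (∀ x, 0 ≤ u x ∧ u x ≤ 1) → (∀ x ∉ U, u x = 0) → (∀ y z, |u y - u z| ≤ L * ρ y z ^ β) →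
      F A u ≤ ENNReal.ofReal (K * L ^ (s / β)) * μ U ^ (1 / p)

/-- The size at scale `2^{-k}` of the gradient of a bump function which is Hölder continuous of
order `β` with constant `L`. -/
noncomputable def bumpCoeff (s β L : ℝ) (k : ℤ) : ℝ :=
  2 ^ (((k : ℝ) + 1) * s) * min 1 (L * 2 ^ (-(k : ℝ) * β))

theorem bumpCoeff_nonneg (s β : ℝ) {L : ℝ} (hL : 0 < L) (k : ℤ) : 0 ≤ bumpCoeff s β L k := by
  unfold bumpCoeff
  positivity

/-- The coefficients decay geometrically away from the scale `2^{-k₀} ≈ L^{-1/β}`. -/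
theorem exists_bumpCoeff_le {s β : ℝ} (hs : 0 < s) (hsβ : s ≤ β) {L : ℝ} (hL : 0 < L) :
    ∃ k₀ : ℤ, ∀ k : ℤ, bumpCoeff s β L k ≤
      2 ^ (s + β) * L ^ (s / β) * 2 ^ (-(min s (β - s)) * |((k - k₀ : ℤ) : ℝ)|) := by
  have hβ : 0 < β := hs.trans_le hsβ
  set l := Real.logb 2 L / β with hl
  have hLl : L = 2 ^ (l * β) := by
    rw [hl, div_mul_cancel₀ _ hβ.ne', Real.rpow_logb (by norm_num) (by norm_num) hL]
  have hLs : L ^ (s / β) = 2 ^ (l * s) := by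
    rw [hLl, ← Real.rpow_mul (by norm_num)]
    congr 1
    field_simp
  refine ⟨⌊l⌋, fun k => ?_⟩
  have h1 := Int.floor_le l
  have h2 := Int.lt_floor_add_one l
  have hε1 : min s (β - s) ≤ s := min_le_left _ _
  have hε2 : min s (β - s) ≤ β - s := min_le_right _ _
  rw [hLs, ← Real.rpow_add (by norm_num), ← Real.rpow_add (by norm_num), bumpCoeff]
  rcases le_or_gt ⌊l⌋ k with hk | hk
  · have hk' : (⌊l⌋ : ℝ) ≤ k := by exact_mod_cast hk
    refine (mul_le_mul_of_nonneg_left (min_le_right _ _) (by positivity)).trans ?_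
    rw [hLl, ← Real.rpow_add (by norm_num), ← Real.rpow_add (by norm_num)]
    refine Real.rpow_le_rpow_of_exponent_le (by norm_num) ?_
    rw [abs_of_nonneg (by push_cast; linarith)]
    push_cast
    nlinarith [mul_le_mul_of_nonneg_right hε2 (sub_nonneg.2 hk'),
      mul_nonneg (sub_nonneg.2 hsβ) (sub_nonneg.2 h2.le)]
  · have hk' : (k : ℝ) ≤ ⌊l⌋ := by exact_mod_cast hk.le
    refine (mul_le_mul_of_nonneg_left (min_le_left _ _) (by positivity)).trans ?_
    rw [mul_one]
    refine Real.rpow_le_rpow_of_exponent_le (by norm_num) ?_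
    rw [abs_of_nonpos (by push_cast; linarith)]
    push_cast
    nlinarith [mul_le_mul_of_nonneg_right hε1 (sub_nonneg.2 hk'),
      mul_nonneg hs.le (sub_nonneg.2 h1)]

theorem exists_seqNorm_bumpCoeff_le {s β : ℝ} (hs : 0 < s) (hsβ : s ≤ β) {q : ℝ≥0∞} (hq : 0 < q)
    (h : q = ∞ ∨ s < β) : ∃ K : ℝ, 0 < K ∧ ∀ L : ℝ, 0 < L →
      seqNorm q (fun k => ENNReal.ofReal (bumpCoeff s β L k)) ≤
        ENNReal.ofReal (K * L ^ (s / β)) := by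
  set W := seqNorm q (fun m : ℤ => ENNReal.ofReal (2 ^ (-(min s (β - s)) * |(m : ℝ)|))) with hW
  have hWtop : W < ∞ := seqNorm_geometric_lt_top (le_min hs.le (by linarith))
    (h.imp id fun h => lt_min hs (by linarith)) hq
  refine ⟨2 ^ (s + β) * (W.toReal + 1), by positivity, fun L hL => ?_⟩
  obtain ⟨k₀, hk₀⟩ := exists_bumpCoeff_le hs hsβ hL
  calc _ ≤ seqNorm q (fun k => ENNReal.ofReal (2 ^ (s + β) * L ^ (s / β)) *
        (fun m : ℤ => ENNReal.ofReal (2 ^ (-(min s (β - s)) * |(m : ℝ)|))) (k - k₀)) := by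
        refine seqNorm_mono fun k => ?_
        rw [← ENNReal.ofReal_mul (by positivity)]
        exact ENNReal.ofReal_le_ofReal (hk₀ k)
    _ = ENNReal.ofReal (2 ^ (s + β) * L ^ (s / β)) * W := by
        rw [seqNorm_const_mul hq]
        congr 1
        exact seqNorm_comp_sub q
          (fun m : ℤ => ENNReal.ofReal (2 ^ (-(min s (β - s)) * |(m : ℝ)|))) k₀
    _ ≤ ENNReal.ofReal (2 ^ (s + β) * L ^ (s / β)) * ENNReal.ofReal (W.toReal + 1) := by
        gcongr
        rw [ENNReal.le_ofReal_iff_toReal_le hWtop.ne (by positivity)]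
        linarith
    _ = _ := by
        rw [← ENNReal.ofReal_mul (by positivity)]
        congr 1
        ring

/-- The canonical fractional gradient of a bump function. -/
theorem isFracGradient_bump {X : Type*} [MeasurableSpace X] {ρ : X → X → ℝ} (μ : Measure X)
    {s β : ℝ} (hs : 0 < s) (hβ : 0 < β) (A : Set X) {U : Set X} {u : X → ℝ} {L : ℝ} (hL : 0 < L) (hU : MeasurableSet U)
    (hu : ∀ x, 0 ≤ u x ∧ u x ≤ 1) (huU : ∀ x ∉ U, u x = 0)
    (hlip : ∀ y z, |u y - u z| ≤ L * ρ y z ^ β) :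
    IsFracGradient ρ μ s A u
      (fun k x => Real.toNNReal (bumpCoeff s β L k) * U.indicator 1 x) := by
  refine ⟨fun k => ((measurable_one.indicator hU).const_mul _).aemeasurable, ∅, measure_empty, ?_⟩
  intro k y _ z _ h1 h2
  have ha := bumpCoeff_nonneg s β hL k
  have hρ0 : 0 < ρ y z := lt_of_lt_of_le (by positivity) h1
  have h1' : (2 : ℝ) ^ (-(k : ℝ) - 1) ≤ ρ y z := by exact_mod_cast h1
  have h2' : ρ y z ≤ (2 : ℝ) ^ (-(k : ℝ)) := by exact_mod_cast h2.le
  have hscale : (1 : ℝ) ≤ ρ y z ^ s * 2 ^ (((k : ℝ) + 1) * s) := by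
    rw [Real.rpow_mul (by norm_num), ← Real.mul_rpow hρ0.le (by positivity)]
    refine Real.one_le_rpow ?_ hs.le
    calc (1 : ℝ) = 2 ^ (-(k : ℝ) - 1) * 2 ^ ((k : ℝ) + 1) := by
          rw [← Real.rpow_add (by norm_num)]; simp
      _ ≤ _ := by gcongr
  have hmin : |u y - u z| ≤ min 1 (L * 2 ^ (-(k : ℝ) * β)) := by
    refine le_min ?_ ((hlip y z).trans ?_)
    · rw [abs_le]
      constructor <;> linarith [hu y, hu z, (hu y).1, (hu y).2, (hu z).1, (hu z).2]
    · rw [Real.rpow_mul (by norm_num)]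
      gcongr
  have hmain : |u y - u z| ≤ ρ y z ^ s * bumpCoeff s β L k := by
    refine hmin.trans ?_
    rw [bumpCoeff, ← mul_assoc]
    exact le_mul_of_one_le_left (by positivity) hscale
  have hpos : 0 ≤ ρ y z ^ s := Real.rpow_nonneg hρ0.le _
  simp only [NNReal.coe_mul, Real.coe_toNNReal _ ha]
  by_cases hy : y ∈ U
  · simp only [indicator_of_mem hy, Pi.one_apply, NNReal.coe_one, mul_one]
    refine hmain.trans (mul_le_mul_of_nonneg_left ?_ hpos)
    have : 0 ≤ bumpCoeff s β L k * ((U.indicator 1 z : ℝ≥0) : ℝ) := by positivity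
    linarith
  · by_cases hz : z ∈ U
    · simpa [hy, hz] using hmain
    · simp [huU y hy, huU z hz, hy, hz]

theorem bumpBound_normM {X : Type*} [MeasurableSpace X] {ρ : X → X → ℝ} {μ : Measure X}
    {s p β : ℝ} (hs : 0 < s) (hp : 0 < p) (hsβ : s ≤ β) {q : ℝ≥0∞}
    (hq : 0 < q) (h : q = ∞ ∨ s < β) : BumpBound ρ μ s p β (normM ρ μ s p q) := by
  obtain ⟨K, hK, hKL⟩ := exists_seqNorm_bumpCoeff_le hs hsβ hq h
  refine ⟨K, hK, fun A U u L hL hU hu huU hlip => ?_⟩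
  refine (iInf₂_le _ (isFracGradient_bump μ hs (hs.trans_le hsβ) A hL hU hu huU hlip)).trans ?_
  have hcoe : ∀ k x, ((Real.toNNReal (bumpCoeff s β L k) * U.indicator 1 x : ℝ≥0) : ℝ≥0∞) =
      U.indicator 1 x * ENNReal.ofReal (bumpCoeff s β L k) := by
    intro k x
    by_cases hx : x ∈ U <;> simp [hx, ENNReal.ofReal]
  simp_rw [hcoe, seqNorm_const_mul hq]
  simp_rw [mul_comm (U.indicator 1 _)]
  have hfin := hKL L hL
  rw [intNorm_const_mul μ hp A (hfin.trans_lt ENNReal.ofReal_lt_top).ne]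
  gcongr
  exact intNorm_indicator_one_le μ hp A hU

theorem bumpBound_normN {X : Type*} [MeasurableSpace X] {ρ : X → X → ℝ} {μ : Measure X}
    {s p β : ℝ} (hs : 0 < s) (hp : 0 < p) (hsβ : s ≤ β) {q : ℝ≥0∞}
    (hq : 0 < q) (h : q = ∞ ∨ s < β) : BumpBound ρ μ s p β (normN ρ μ s p q) := by
  obtain ⟨K, hK, hKL⟩ := exists_seqNorm_bumpCoeff_le hs hsβ hq h
  refine ⟨K, hK, fun A U u L hL hU hu huU hlip => ?_⟩
  refine (iInf₂_le _ (isFracGradient_bump μ hs (hs.trans_le hsβ) A hL hU hu huU hlip)).trans ?_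
  have hcoe : ∀ k x, ((Real.toNNReal (bumpCoeff s β L k) * U.indicator 1 x : ℝ≥0) : ℝ≥0∞) =
      ENNReal.ofReal (bumpCoeff s β L k) * U.indicator 1 x := by
    intro k x
    by_cases hx : x ∈ U <;> simp [hx, ENNReal.ofReal]
  simp_rw [hcoe, intNorm_const_mul μ hp A ENNReal.ofReal_ne_top]
  simp_rw [mul_comm _ (intNorm _ _ _ _)]
  rw [seqNorm_const_mul hq, mul_comm]
  gcongr
  · exact hKL L hL
  · exact intNorm_indicator_one_le μ hp A hU

/-! ### Pointwise estimates by telescoping -/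

theorem half_pow_rpow (j : ℕ) (s : ℝ) : ((1 / 2 : ℝ) ^ j) ^ s = ((2 : ℝ) ^ (-s)) ^ j := by
  rw [← Real.rpow_natCast, ← Real.rpow_natCast, ← Real.rpow_mul (by norm_num),
    ← Real.rpow_mul (by norm_num), one_div, Real.inv_rpow (by norm_num),
    ← Real.rpow_neg (by norm_num)]
  congr 1
  ring

theorem scale_mul (a s : ℝ) (j : ℕ) :
    ((1 / 2 : ℝ) ^ j) ^ s * ((2 : ℝ) ^ a) ^ j = ((2 : ℝ) ^ (a - s)) ^ j := by
  rw [half_pow_rpow, ← mul_pow, ← Real.rpow_add (by norm_num)]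
  congr 2
  ring

/-- The data shared by the pointwise estimates: on the set `P` the differences of `u` are
controlled by `g`, and every small ball `B(y, t)` centred in `B(x, r)` contains a point of `P` at
which `g` is at most `H (r / t)^a`. -/
structure HasGoodPoints {X : Type*} (ρ : X → X → ℝ) (s a : ℝ) (x : X) (r H : ℝ) (P : Set X)
    (u g : X → ℝ) : Prop where
  nonneg : ∀ y, 0 ≤ g y
  grad : ∀ y ∈ P, ∀ z ∈ P, |u y - u z| ≤ ρ y z ^ s * (g y + g z)
  good : ∀ y ∈ qball ρ x r, ∀ t : ℝ, 0 < t → t ≤ r →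
    ∃ w ∈ P, ρ y w < t ∧ g w ≤ H * (r / t) ^ a

section

variable {X : Type*} {ρ : X → X → ℝ} {s a : ℝ} {x : X} {r H K : ℝ} {P : Set X} {u g : X → ℝ}

/-- Good points in the balls `B(y, 2^{-j} r)` form a sequence along which the increments of `u` are
geometric with ratio `2^{a-s}`. All the balls are centred at `y`, so that no chain of balls has to
be kept inside a larger ball. -/
theorem HasGoodPoints.exists_seq (h : HasGoodPoints ρ s a x r H P u g) (hρ : IsQuasiMetric ρ)
    (hK : 1 ≤ K) (hKs : ∀ x y, ρ y x ≤ K * ρ x y)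
    (hKt : ∀ x y z, ρ x y ≤ K * max (ρ x z) (ρ z y)) (hs : 0 < s)
    (hr : 0 < r) (hH : 0 < H) {y : X} (hy : y ∈ qball ρ x r) :
    ∃ w : ℕ → X, (∀ j, w j ∈ P) ∧ (∀ j, ρ y (w j) < r * (1 / 2) ^ j) ∧
      (∀ j, g (w j) ≤ H * (2 ^ a) ^ j) ∧
      ∀ j, |u (w j) - u (w (j + 1))| ≤
        (K ^ 2) ^ s * (1 + 2 ^ a) * (r ^ s * H) * (2 ^ (a - s)) ^ j := by
  have hchoose : ∀ j : ℕ, ∃ w ∈ P, ρ y w < r * (1 / 2) ^ j ∧ g w ≤ H * (2 ^ a) ^ j := by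
    intro j
    obtain ⟨w, hw, h1, h2⟩ := h.good y hy (r * (1 / 2) ^ j) (by positivity)
      (mul_le_of_le_one_right hr.le (pow_le_one₀ (by norm_num) (by norm_num)))
    refine ⟨w, hw, h1, h2.trans_eq ?_⟩
    congr 1
    have : r / (r * (1 / 2) ^ j) = 2 ^ j := by
      field_simp
      rw [← mul_pow]
      norm_num
    rw [this, ← Real.rpow_natCast, ← Real.rpow_natCast, ← Real.rpow_mul (by norm_num),
      ← Real.rpow_mul (by norm_num), mul_comm]
  choose w hwP hw1 hw2 using hchoose
  refine ⟨w, hwP, hw1, hw2, fun j => ?_⟩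
  have ht : 0 < r * (1 / 2 : ℝ) ^ j := by positivity
  have hdist : ρ (w j) (w (j + 1)) ≤ K ^ 2 * (r * (1 / 2) ^ j) := by
    have h1 : ρ (w j) y ≤ K * (r * (1 / 2) ^ j) := (hKs _ _).trans (by gcongr; exact (hw1 j).le)
    have h2 : ρ y (w (j + 1)) ≤ K * (r * (1 / 2) ^ j) := by
      refine (hw1 (j + 1)).le.trans ?_
      rw [pow_succ]
      nlinarith
    calc _ ≤ K * max (ρ (w j) y) (ρ y (w (j + 1))) := hKt _ _ _
      _ ≤ K * (K * (r * (1 / 2) ^ j)) := by gcongr; exact max_le h1 h2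
      _ = _ := by ring
  calc |u (w j) - u (w (j + 1))|
      ≤ ρ (w j) (w (j + 1)) ^ s * (g (w j) + g (w (j + 1))) := h.grad _ (hwP _) _ (hwP _)
    _ ≤ ρ (w j) (w (j + 1)) ^ s * (H * (2 ^ a) ^ j + H * (2 ^ a) ^ (j + 1)) := by
        have := Real.rpow_nonneg (hρ.nonneg (w j) (w (j + 1))) s
        gcongr
        · exact hw2 j
        · exact hw2 (j + 1)
    _ ≤ (K ^ 2 * (r * (1 / 2) ^ j)) ^ s * (H * (2 ^ a) ^ j + H * (2 ^ a) ^ (j + 1)) := by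
        have := Real.rpow_le_rpow (hρ.nonneg _ _) hdist hs.le
        gcongr
    _ = _ := by
        rw [Real.mul_rpow (by positivity) ht.le, Real.mul_rpow hr.le (by positivity),
          ← scale_mul, pow_succ]
        ring

/-- The Hölder case `a < s`: the values of `u` along good points converging to `y` converge
geometrically, and the limit is a Hölder continuous representative of `u`. -/
theorem HasGoodPoints.exists_holder (hρ : IsQuasiMetric ρ) (hs : 0 < s)
    (has : a < s) : ∃ C : ℝ, 0 < C ∧ ∀ (x : X) (r H : ℝ) (P : Set X) (u g : X → ℝ),
      0 < r → 0 < H → HasGoodPoints ρ s a x r H P u g →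
      ∃ v : X → ℝ, (∀ y ∈ qball ρ x r, y ∈ P → v y = u y) ∧
        ∀ y ∈ qball ρ x r, ∀ z ∈ qball ρ x r,
          |v y - v z| ≤ C * (r ^ a * H) * ρ y z ^ (s - a) := by
  obtain ⟨K, hK, hKs, hKt⟩ := hρ.exists_const
  set θ : ℝ := 2 ^ (a - s) with hθ
  have hθ0 : 0 < θ := by positivity
  have hθ1 : θ < 1 := Real.rpow_lt_one_of_one_lt_of_neg (by norm_num) (by linarith)
  have hθ1' : 0 < 1 - θ := by linarith
  set C₁ : ℝ := (K ^ 2) ^ s * (1 + 2 ^ a) with hC₁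
  have hC₁0 : 0 < C₁ := by positivity
  refine ⟨2 * (C₁ / (1 - θ)) + 2 * (2 * K ^ 4) ^ s, by positivity, ?_⟩
  intro x r H P u g hr hH h
  have key : ∀ y ∈ qball ρ x r, ∃ (w : ℕ → X) (l : ℝ), (∀ j, w j ∈ P) ∧
      (∀ j, ρ y (w j) < r * (1 / 2) ^ j) ∧ (∀ j, g (w j) ≤ H * (2 ^ a) ^ j) ∧
      (∀ j, |u (w j) - l| ≤ C₁ / (1 - θ) * (r ^ s * H) * θ ^ j) ∧ (y ∈ P → l = u y) := by
    intro y hy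
    obtain ⟨w, hwP, hw1, hw2, hw3⟩ := h.exists_seq hρ hK hKs hKt hs hr hH hy
    obtain ⟨l, hl⟩ := cauchySeq_tendsto_of_complete
      (cauchySeq_of_le_geometric θ _ hθ1 (f := fun j => u (w j)) hw3)
    refine ⟨w, l, hwP, hw1, hw2, fun j => ?_, fun hyP => tendsto_nhds_unique hl ?_⟩
    · have := dist_le_of_le_geometric_of_tendsto θ _ hθ1 (f := fun j => u (w j)) hw3 hl j
      rw [Real.dist_eq] at this
      refine this.trans_eq ?_
      ring
    · have hbound : ∀ j, dist (u (w j)) (u y) ≤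
          r ^ s * g y * (2 ^ (-s)) ^ j + r ^ s * H * θ ^ j := by
        intro j
        rw [dist_comm, Real.dist_eq]
        have h0 := h.nonneg y
        have h1 := Real.rpow_le_rpow (hρ.nonneg _ _) (hw1 j).le hs.le
        have h2 := hw2 j
        have h3 := h.nonneg (w j)
        calc |u y - u (w j)| ≤ ρ y (w j) ^ s * (g y + g (w j)) := h.grad y hyP (w j) (hwP j)
          _ ≤ (r * (1 / 2) ^ j) ^ s * (g y + H * (2 ^ a) ^ j) := by gcongr
          _ = _ := by
            rw [Real.mul_rpow hr.le (by positivity), hθ, ← scale_mul, ← half_pow_rpow]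
            ring
      have hlim : Filter.Tendsto (fun j : ℕ => r ^ s * g y * ((2 : ℝ) ^ (-s)) ^ j +
          r ^ s * H * θ ^ j) Filter.atTop (nhds (r ^ s * g y * 0 + r ^ s * H * 0)) := by
        refine Filter.Tendsto.add ?_ ?_
        · exact (tendsto_pow_atTop_nhds_zero_of_lt_one (by positivity)
            (Real.rpow_lt_one_of_one_lt_of_neg (by norm_num) (by linarith))).const_mul _
        · exact (tendsto_pow_atTop_nhds_zero_of_lt_one hθ0.le hθ1).const_mul _
      rw [tendsto_iff_dist_tendsto_zero]
      exact squeeze_zero (fun _ => dist_nonneg) hbound (by simpa using hlim)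
  choose! w v hwP hw1 hw2 hw3 hv using key
  refine ⟨v, hv, fun y hy z hz => ?_⟩
  by_cases hyz : y = z
  · subst hyz
    have := Real.rpow_nonneg (hρ.nonneg y y) (s - a)
    simp only [sub_self, abs_zero]
    positivity
  have hd : 0 < ρ y z := hρ.pos hyz
  have hdr : ρ y z ≤ K ^ 2 * r := by
    have h1 : ρ y x ≤ K * r := (hKs _ _).trans (by gcongr; exact le_of_lt hy)
    have h2 : ρ x z ≤ K * r := (le_of_lt hz).trans (le_mul_of_one_le_left hr.le hK)
    calc _ ≤ K * max (ρ y x) (ρ x z) := hKt _ _ _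
      _ ≤ K * (K * r) := by gcongr; exact max_le h1 h2
      _ = _ := by ring
  -- a dyadic radius `t` comparable to `ρ y z` and at most `r`
  obtain ⟨j, hj1, hj2⟩ := exists_nat_pow_near_of_lt_one (x := min (ρ y z) r / r) (y := (1 / 2 : ℝ))
    (by positivity) ((div_le_one hr).2 (min_le_right _ _)) (by norm_num) (by norm_num)
  set t : ℝ := r * (1 / 2) ^ (j + 1) with ht
  have ht0 : 0 < t := by positivity
  have ht1 : t < min (ρ y z) r := by
    rw [lt_div_iff₀ hr] at hj1
    linarith
  have ht2 : min (ρ y z) r ≤ 2 * t := by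
    rw [div_le_iff₀ hr] at hj2
    rw [ht, pow_succ]
    linarith
  have htd : t ≤ ρ y z := ht1.le.trans (min_le_left _ _)
  have hdt : ρ y z ≤ 2 * K ^ 2 * t := by
    rcases le_total (ρ y z) r with hle | hle
    · rw [min_eq_left hle] at ht2
      nlinarith [one_le_pow₀ hK (n := 2)]
    · rw [min_eq_right hle] at ht2
      nlinarith [one_le_pow₀ hK (n := 2)]
  have hww : ρ (w y (j + 1)) (w z (j + 1)) ≤ 2 * K ^ 4 * t := by
    have hK2 := one_le_pow₀ hK (n := 2)
    have h1 : ρ (w y (j + 1)) y ≤ K * (2 * K ^ 2 * t) := by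
      refine (hKs _ _).trans ?_
      have := hw1 y hy (j + 1)
      gcongr
      nlinarith
    have h2 : ρ y (w z (j + 1)) ≤ K * (2 * K ^ 2 * t) := by
      refine (hKt _ _ z).trans ?_
      have := hw1 z hz (j + 1)
      gcongr
      exact max_le hdt (by nlinarith)
    calc _ ≤ K * max (ρ (w y (j + 1)) y) (ρ y (w z (j + 1))) := hKt _ _ _
      _ ≤ K * (K * (2 * K ^ 2 * t)) := by gcongr; exact max_le h1 h2
      _ = _ := by ring
  have hts : t ^ s * (2 ^ a) ^ (j + 1) = r ^ s * θ ^ (j + 1) := by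
    rw [ht, Real.mul_rpow hr.le (by positivity), mul_assoc, scale_mul]
  have hts' : r ^ s * θ ^ (j + 1) = r ^ a * t ^ (s - a) := by
    have : r ^ s = r ^ a * r ^ (s - a) := by rw [← Real.rpow_add hr]; congr 1; ring
    rw [ht, Real.mul_rpow hr.le (by positivity), half_pow_rpow, neg_sub, this, mul_assoc]
  have hmid : |u (w y (j + 1)) - u (w z (j + 1))| ≤
      (2 * K ^ 4) ^ s * (2 * H) * (r ^ s * θ ^ (j + 1)) := by
    have h1 := hw2 y hy (j + 1)
    have h2 := hw2 z hz (j + 1)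
    have h3 := h.nonneg (w y (j + 1))
    have h4 := h.nonneg (w z (j + 1))
    have h5 := Real.rpow_le_rpow (hρ.nonneg _ _) hww hs.le
    calc _ ≤ ρ (w y (j + 1)) (w z (j + 1)) ^ s * (g (w y (j + 1)) + g (w z (j + 1))) :=
          h.grad _ (hwP y hy _) _ (hwP z hz _)
      _ ≤ (2 * K ^ 4 * t) ^ s * (H * (2 ^ a) ^ (j + 1) + H * (2 ^ a) ^ (j + 1)) := by gcongr
      _ = _ := by
        rw [← hts, Real.mul_rpow (by positivity) ht0.le]
        ring
  have hvy := hw3 y hy (j + 1)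
  have hvz := hw3 z hz (j + 1)
  rw [abs_sub_comm] at hvy
  calc |v y - v z| ≤ |v y - u (w y (j + 1))| + |u (w y (j + 1)) - u (w z (j + 1))| +
        |u (w z (j + 1)) - v z| :=
        (abs_sub_le _ (u (w z (j + 1))) _).trans (by gcongr; exact abs_sub_le _ _ _)
    _ ≤ (2 * (C₁ / (1 - θ)) + 2 * (2 * K ^ 4) ^ s) * H * (r ^ s * θ ^ (j + 1)) := by linarith
    _ = (2 * (C₁ / (1 - θ)) + 2 * (2 * K ^ 4) ^ s) * (r ^ a * H) * t ^ (s - a) := by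
        rw [hts']
        ring
    _ ≤ _ := by
        have := Real.rpow_le_rpow ht0.le htd (by linarith : 0 ≤ s - a)
        gcongr

/-- The Sobolev case `a > s`, a pointwise inequality of Hedberg type: telescoping from `x` to scale
`t` costs `t^s g(x)` below that scale and `H t^{s-a}` above it, and `t` is chosen such that both
terms agree. -/
theorem HasGoodPoints.exists_hedberg (hρ : IsQuasiMetric ρ) (hs : 0 < s)
    (has : s < a) : ∃ C : ℝ, 0 < C ∧ ∀ (x : X) (r H : ℝ) (P : Set X) (u g : X → ℝ),
      0 < r → 0 < H → HasGoodPoints ρ s a x r H P u g →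
      ∀ y ∈ qball ρ x r, y ∈ P → ∀ z ∈ qball ρ x r, z ∈ P →
        |u y - u z| ≤ C * (r ^ s * H * ((g y / H) ^ (1 - s / a) + 1) + r ^ s * g z) := by
  obtain ⟨K, hK, hKs, hKt⟩ := hρ.exists_const
  have ha : 0 < a := hs.trans has
  set θ : ℝ := 2 ^ (a - s) with hθ
  have hθ1 : 1 < θ := Real.one_lt_rpow (by norm_num) (by linarith)
  have hθ1' : 0 < θ - 1 := by linarith
  have hθ0 : 0 < θ := by linarith
  set C₁ : ℝ := (K ^ 2) ^ s * (1 + 2 ^ a) with hC₁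
  have hC₁0 : 0 < C₁ := by positivity
  set C₂ : ℝ := C₁ / (θ - 1) with hC₂
  have hC₂0 : 0 < C₂ := by positivity
  refine ⟨(2 ^ s + 2 + C₂) + (K ^ 3) ^ s, by positivity, ?_⟩
  intro x r H P u g hr hH h y hy hyP z hz hzP
  obtain ⟨w, hwP, hw1, hw2, hw3⟩ := h.exists_seq hρ hK hKs hKt hs hr hH hy
  have hgy := h.nonneg y
  have hgz := h.nonneg z
  -- telescoping up to the scale `j`
  have htel : ∀ j, |u y - u (w 0)| ≤
      r ^ s * (2 ^ (-s)) ^ j * g y + (1 + C₂) * (r ^ s * H * θ ^ j) := by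
    intro j
    have h1 : |u y - u (w j)| ≤ r ^ s * (2 ^ (-s)) ^ j * g y + r ^ s * H * θ ^ j := by
      have h1 := Real.rpow_le_rpow (hρ.nonneg _ _) (hw1 j).le hs.le
      have h2 := hw2 j
      have h3 := h.nonneg (w j)
      calc |u y - u (w j)| ≤ ρ y (w j) ^ s * (g y + g (w j)) := h.grad y hyP (w j) (hwP j)
        _ ≤ (r * (1 / 2) ^ j) ^ s * (g y + H * (2 ^ a) ^ j) := by gcongr
        _ = _ := by
          rw [Real.mul_rpow hr.le (by positivity), hθ, ← scale_mul, ← half_pow_rpow]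
          ring
    have h2 : |u (w 0) - u (w j)| ≤ C₂ * (r ^ s * H * θ ^ j) := by
      have := dist_le_range_sum_of_dist_le (f := fun j => u (w j))
        (d := fun j => C₁ * (r ^ s * H) * θ ^ j) j (fun {k} _ => hw3 k)
      rw [Real.dist_eq, ← Finset.mul_sum, geom_sum_eq hθ1.ne'] at this
      refine this.trans ?_
      have h3 : (θ ^ j - 1) / (θ - 1) ≤ θ ^ j / (θ - 1) := by gcongr; linarith
      calc _ ≤ C₁ * (r ^ s * H) * (θ ^ j / (θ - 1)) := by gcongr
        _ = _ := by rw [hC₂]; ring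
    rw [abs_sub_comm] at h2
    linarith [abs_sub_le (u y) (u (w j)) (u (w 0))]
  have hfirst : |u y - u (w 0)| ≤
      (2 ^ s + 2 + C₂) * (r ^ s * H * ((g y / H) ^ (1 - s / a) + 1)) := by
    have h2s : (0 : ℝ) < 2 ^ s := by positivity
    rcases le_total (g y) H with hle | hle
    · have h0 := htel 0
      simp only [pow_zero, mul_one] at h0
      have h1 : (0 : ℝ) ≤ (g y / H) ^ (1 - s / a) := by positivity
      calc _ ≤ r ^ s * g y + (1 + C₂) * (r ^ s * H) := h0
        _ ≤ r ^ s * H + (1 + C₂) * (r ^ s * H) := by gcongr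
        _ = (0 + 2 + C₂) * (r ^ s * H * (0 + 1)) := by ring
        _ ≤ _ := by gcongr
    · have h2a : (1 : ℝ) < 2 ^ a := Real.one_lt_rpow (by norm_num) ha
      obtain ⟨j, hj1, hj2⟩ := exists_nat_pow_near ((one_le_div hH).2 hle) h2a
      set G := g y / H with hG
      have hG1 : 1 ≤ G := (one_le_div hH).2 hle
      have hG0 : 0 < G := by linarith
      have hgG : g y = H * G := by rw [hG]; field_simp
      have e0 : 0 ≤ 1 - s / a := by rw [sub_nonneg, div_le_one ha]; exact has.le
      have hθj : θ ^ j ≤ G ^ (1 - s / a) := by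
        calc θ ^ j = ((2 ^ a) ^ j) ^ (1 - s / a) := by
              rw [hθ, ← Real.rpow_natCast, ← Real.rpow_natCast, ← Real.rpow_mul (by positivity),
                ← Real.rpow_mul (by positivity), ← Real.rpow_mul (by positivity)]
              congr 1
              field_simp
          _ ≤ _ := Real.rpow_le_rpow (by positivity) hj1 e0
      have hsj : (2 ^ (-s)) ^ j * G ≤ 2 ^ s * G ^ (1 - s / a) := by
        have h1 : G ^ (s / a) ≤ 2 ^ s * (2 ^ s) ^ j := by
          calc G ^ (s / a) ≤ ((2 ^ a) ^ (j + 1)) ^ (s / a) :=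
                Real.rpow_le_rpow hG0.le hj2.le (by positivity)
            _ = (2 ^ s) ^ (j + 1) := by
                rw [← Real.rpow_natCast, ← Real.rpow_natCast, ← Real.rpow_mul (by positivity),
                  ← Real.rpow_mul (by positivity), ← Real.rpow_mul (by positivity)]
                congr 1
                field_simp
            _ = _ := by ring
        rw [Real.rpow_sub hG0, Real.rpow_one, Real.rpow_neg (by norm_num), inv_pow,
          inv_mul_le_iff₀ (by positivity), mul_div_assoc', mul_div_assoc',
          le_div_iff₀ (by positivity)]
        calc G * G ^ (s / a) ≤ G * (2 ^ s * (2 ^ s) ^ j) := by gcongr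
          _ = _ := by ring
      calc _ ≤ r ^ s * (2 ^ (-s)) ^ j * g y + (1 + C₂) * (r ^ s * H * θ ^ j) := htel j
        _ = r ^ s * H * ((2 ^ (-s)) ^ j * G) + (1 + C₂) * (r ^ s * H * θ ^ j) := by
            rw [hgG]; ring
        _ ≤ r ^ s * H * (2 ^ s * G ^ (1 - s / a)) +
            (1 + C₂) * (r ^ s * H * G ^ (1 - s / a)) := by gcongr
        _ = (2 ^ s + 1 + C₂) * (r ^ s * H * (G ^ (1 - s / a) + 0)) := by ring
        _ ≤ _ := by gcongr <;> norm_num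
  have hsecond : |u (w 0) - u z| ≤ (K ^ 3) ^ s * (r ^ s * H + r ^ s * g z) := by
    have hw0 := hw1 0
    have hw0' := hw2 0
    simp only [pow_zero, mul_one] at hw0 hw0'
    have hd : ρ (w 0) z ≤ K ^ 3 * r := by
      have h1 : ρ (w 0) y ≤ K ^ 2 * r := by
        refine (hKs _ _).trans ?_
        calc _ ≤ K * (K * r) := by
              gcongr
              exact hw0.le.trans (le_mul_of_one_le_left hr.le hK)
          _ = _ := by ring
      have h2 : ρ y z ≤ K ^ 2 * r := by
        have h1 : ρ y x ≤ K * r := (hKs _ _).trans (by gcongr; exact le_of_lt hy)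
        have h2 : ρ x z ≤ K * r := (le_of_lt hz).trans (le_mul_of_one_le_left hr.le hK)
        calc _ ≤ K * max (ρ y x) (ρ x z) := hKt _ _ _
          _ ≤ K * (K * r) := by gcongr; exact max_le h1 h2
          _ = _ := by ring
      calc _ ≤ K * max (ρ (w 0) y) (ρ y z) := hKt _ _ _
        _ ≤ K * (K ^ 2 * r) := by gcongr; exact max_le h1 h2
        _ = _ := by ring
    have h3 := Real.rpow_le_rpow (hρ.nonneg _ _) hd hs.le
    have h4 := h.nonneg (w 0)
    calc _ ≤ ρ (w 0) z ^ s * (g (w 0) + g z) := h.grad _ (hwP 0) _ hzP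
      _ ≤ (K ^ 3 * r) ^ s * (H + g z) := by gcongr
      _ = _ := by
        rw [Real.mul_rpow (by positivity) hr.le]
        ring
  have hG0 : (0 : ℝ) ≤ (g y / H) ^ (1 - s / a) := by positivity
  have hR : 0 ≤ r ^ s * g z := by positivity
  have hR' : 0 ≤ r ^ s * H * (g y / H) ^ (1 - s / a) := by positivity
  calc |u y - u z| ≤ |u y - u (w 0)| + |u (w 0) - u z| := abs_sub_le _ _ _
    _ ≤ (2 ^ s + 2 + C₂) * (r ^ s * H * ((g y / H) ^ (1 - s / a) + 1)) +
        (K ^ 3) ^ s * (r ^ s * H + r ^ s * g z) := add_le_add hfirst hsecond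
    _ ≤ (2 ^ s + 2 + C₂) * (r ^ s * H * ((g y / H) ^ (1 - s / a) + 1) + r ^ s * g z) +
        (K ^ 3) ^ s * (r ^ s * H * ((g y / H) ^ (1 - s / a) + 1) + r ^ s * g z) := by
        refine add_le_add (mul_le_mul_of_nonneg_left ?_ (by positivity))
          (mul_le_mul_of_nonneg_left ?_ (by positivity)) <;> linarith
    _ = _ := by ring

end

/-! ### From the doubling property to the embeddings -/

section

variable {X : Type*} [MeasurableSpace X] {ρ : X → X → ℝ} {μ : Measure X}

theorem IsQuasiMetricMeasure.toReal_ball_pos (hX : IsQuasiMetricMeasure ρ μ) (x : X) {r : ℝ}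
    (hr : 0 < r) : 0 < (μ (qball ρ x r)).toReal :=
  ENNReal.toReal_pos (hX.ball_pos x r hr).ne' (hX.ball_lt_top x r hr).ne

/-- The lower bound on the measure of small balls in the form used below. Balls `B(y, t)` with
`y ∈ B(x, r)` and `t ≤ r` are contained in `B(x, σ r)` as `σ ≥ C_ρ`. -/
theorem IsQDoubling.exists_const [Nontrivial X] (hX : IsQuasiMetricMeasure ρ μ) {Q σ : ℝ}
    (hσ : triConst ρ ≤ σ) (hd : IsQDoubling ρ μ Q) :
    ∃ c : ℝ, 1 ≤ c ∧ ∀ (x : X) (r : ℝ), 0 < r → ∀ y ∈ qball ρ x r, ∀ t : ℝ, 0 < t → t ≤ r →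
      qball ρ y t ⊆ qball ρ x (σ * r) ∧
      (μ (qball ρ x (σ * r))).toReal * (t / r) ^ Q ≤ c * (μ (qball ρ y t)).toReal := by
  obtain ⟨κ, hκ, hd⟩ := hd
  have hT := hX.quasiMetric.one_le_triConst
  have hσ1 : 1 ≤ σ := hT.trans hσ
  have hσ0 : 0 < σ := by linarith
  refine ⟨max 1 (σ ^ Q / κ), le_max_left _ _, fun x r hr y hy t ht htr => ?_⟩
  have hsub : qball ρ y t ⊆ qball ρ x (σ * r) := by
    intro z hz
    have hy' : ρ x y < r := hy
    have hz' : ρ y z < t := hz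
    have h0 : 0 ≤ max (ρ x y) (ρ y z) := le_max_of_le_left (hX.quasiMetric.nonneg _ _)
    calc ρ x z ≤ triConst ρ * max (ρ x y) (ρ y z) := hX.quasiMetric.le_triConst_mul x z y
      _ ≤ σ * max (ρ x y) (ρ y z) := by gcongr
      _ < σ * r := by gcongr; exact max_lt hy' (hz'.trans_le htr)
  refine ⟨hsub, ?_⟩
  have hm := hX.toReal_ball_pos x (mul_pos hσ0 hr)
  have hb := hX.toReal_ball_pos y ht
  have h1 := hd y x t (σ * r) ht (htr.trans (le_mul_of_one_le_left hr.le hσ1)) hsub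
  rw [ENNReal.ofReal_le_iff_le_toReal
    (ENNReal.div_lt_top (hX.ball_lt_top y t ht).ne (hX.ball_pos x _ (mul_pos hσ0 hr)).ne').ne,
    ENNReal.toReal_div, le_div_iff₀ hm] at h1
  have h2 : (t / (σ * r)) ^ Q = (t / r) ^ Q / σ ^ Q := by
    rw [← Real.div_rpow (by positivity) hσ0.le]
    congr 1
    field_simp
  rw [h2] at h1
  calc _ = σ ^ Q / κ * (κ * ((t / r) ^ Q / σ ^ Q) * (μ (qball ρ x (σ * r))).toReal) := by
        field_simp
    _ ≤ σ ^ Q / κ * (μ (qball ρ y t)).toReal := by gcongr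
    _ ≤ _ := by gcongr; exact le_max_right _ _

/-- Chebyshev's inequality: outside any null set, a function attains a value which does not
exceed its mean on `B(y, t)`. -/
theorem exists_le_of_lintegral_le (hX : IsQuasiMetricMeasure ρ μ) {A E : Set X} {y : X}
    {t c θ I : ℝ} (ht : 0 < t) (hθ : 0 < θ) (hI : 0 ≤ I)
    (hsub : qball ρ y t ⊆ A) (hm : 0 < (μ A).toReal)
    (hc : (μ A).toReal * θ ≤ c * (μ (qball ρ y t)).toReal) (hE : μ E = 0) {f : X → ℝ≥0∞}
    (hf : AEMeasurable f (μ.restrict A)) (hfI : ∫⁻ z in A, f z ∂μ ≤ ENNReal.ofReal I) :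
    ∃ w ∈ A \ E, ρ y w < t ∧ f w ≤ ENNReal.ofReal (c * I / (μ A).toReal * θ⁻¹) := by
  have hpos := measure_le_setLAverage_pos (hX.ball_pos y t ht).ne' (hX.ball_lt_top y t ht).ne
    (hf.mono_measure (Measure.restrict_mono hsub le_rfl))
  rw [← measure_sdiff_null hE] at hpos
  obtain ⟨w, ⟨hw1, hw2⟩, hwE⟩ := nonempty_of_measure_ne_zero hpos.ne'
  refine ⟨w, ⟨hsub hw1, hwE⟩, hw1, hw2.trans ?_⟩
  have hb := hX.toReal_ball_pos y ht
  rw [setLAverage_eq, ← ENNReal.ofReal_toReal (hX.ball_lt_top y t ht).ne]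
  calc _ ≤ ENNReal.ofReal I / ENNReal.ofReal (μ (qball ρ y t)).toReal := by
        gcongr
        exact (lintegral_mono_set hsub).trans hfI
    _ = ENNReal.ofReal (I / (μ (qball ρ y t)).toReal) := (ENNReal.ofReal_div_of_pos hb).symm
    _ ≤ _ := by
        refine ENNReal.ofReal_le_ofReal ?_
        rw [div_le_iff₀ hb]
        calc I = I / (μ A).toReal * θ⁻¹ * ((μ A).toReal * θ) := by field_simp
          _ ≤ I / (μ A).toReal * θ⁻¹ * (c * (μ (qball ρ y t)).toReal) := by gcongr
          _ = _ := by ring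

theorem le_rpow_mul_of_rpow_le {p c N m e a : ℝ} (hp : 0 < p) (hc : 0 ≤ c) (hN : 0 ≤ N)
    (hm : 0 < m) (he : 0 < e) {g : ℝ} (hg : 0 ≤ g) (h : g ^ p ≤ c * N ^ p / m * (e ^ (a * p))) :
    g ≤ c ^ (1 / p) * N / m ^ (1 / p) * e ^ a := by
  rw [← Real.rpow_le_rpow_iff hg (by positivity) hp]
  refine h.trans_eq ?_
  rw [Real.mul_rpow (by positivity) (by positivity), Real.div_rpow (by positivity) (by positivity),
    Real.mul_rpow (by positivity) hN, ← Real.rpow_mul hc, ← Real.rpow_mul hm.le,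
    ← Real.rpow_mul he.le, one_div_mul_cancel hp.ne', Real.rpow_one, Real.rpow_one]

/-- On a doubling space, Hajłasz gradients in `L^p` provide good points. -/
theorem hasGoodPoints_of_gradient (hX : IsQuasiMetricMeasure ρ μ) {s p Q c : ℝ} (hp : 0 < p)
    (hc : 1 ≤ c) {x : X} {r : ℝ} (hr : 0 < r) {A E : Set X} (hm : 0 < (μ A).toReal)
    (hdoub : ∀ y ∈ qball ρ x r, ∀ t : ℝ, 0 < t → t ≤ r → qball ρ y t ⊆ A ∧
      (μ A).toReal * (t / r) ^ Q ≤ c * (μ (qball ρ y t)).toReal)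
    {u : X → ℝ} {g : X → ℝ≥0} (hg : AEMeasurable g (μ.restrict A)) (hE : μ E = 0)
    (hgrad : ∀ x ∈ A \ E, ∀ y ∈ A \ E, |u x - u y| ≤ ρ x y ^ s * ((g x : ℝ) + (g y : ℝ)))
    {N : ℝ} (hN : 0 < N)
    (hgN : ∫⁻ z in A, (g z : ℝ≥0∞) ^ p ∂μ ≤ ENNReal.ofReal N ^ p) :
    HasGoodPoints ρ s (Q / p) x r (c ^ (1 / p) * N / (μ A).toReal ^ (1 / p)) (A \ E) u
      (fun z => (g z : ℝ)) := by
  refine ⟨fun y => (g y).2, hgrad, fun y hy t ht htr => ?_⟩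
  obtain ⟨hsub, hle⟩ := hdoub y hy t ht htr
  rw [ENNReal.ofReal_rpow_of_nonneg hN.le hp.le] at hgN
  obtain ⟨w, hw, hw1, hw2⟩ := exists_le_of_lintegral_le hX ht (by positivity) (by positivity)
    hsub hm hle hE (hg.coe_nnreal_ennreal.pow_const p) hgN
  refine ⟨w, hw, hw1, le_rpow_mul_of_rpow_le hp (by linarith) hN.le hm (by positivity)
    (g w).2 ?_⟩
  rw [← ENNReal.ofReal_coe_nnreal, ENNReal.ofReal_rpow_of_nonneg (g w).coe_nonneg hp.le,
    ENNReal.ofReal_le_ofReal_iff (by positivity)] at hw2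
  refine hw2.trans_eq ?_
  rw [div_mul_cancel₀ _ hp.ne', ← Real.inv_rpow (by positivity), inv_div]

theorem ae_restrict_ball_notMem (hX : IsQuasiMetricMeasure ρ μ) (x : X) {r : ℝ} (hr : 0 < r)
    {E : Set X} (hE : μ E = 0) : ∀ᵐ y ∂μ.restrict (qball ρ x r), y ∈ qball ρ x r ∧ y ∉ E := by
  filter_upwards [ae_restrict_mem₀ (hX.nullMeasurableSet_ball x r hr),
    ae_restrict_of_ae (measure_eq_zero_iff_ae_notMem.1 hE)] with y h1 h2 using ⟨h1, h2⟩

theorem localHolder_of_isQDoubling [Nontrivial X] (hX : IsQuasiMetricMeasure ρ μ) {Q σ s p : ℝ}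
    (hQ : 0 < Q) (hσ : triConst ρ ≤ σ) (hd : IsQDoubling ρ μ Q) (hs : 0 < s) (hp : Q / s < p)
    {F : Set X → (X → ℝ) → ℝ≥0∞} (hF : DominatesHajlasz ρ μ s p F) :
    LocalHolder ρ μ F Q s σ p := by
  have hp0 : 0 < p := lt_trans (by positivity) hp
  have has : Q / p < s := by
    rw [div_lt_iff₀ hs] at hp
    rw [div_lt_iff₀ hp0]
    linarith
  have hσ0 : 0 < σ := by linarith [hX.quasiMetric.one_le_triConst]
  obtain ⟨c, hc, hdoub⟩ := hd.exists_const hX hσ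
  obtain ⟨C, hC, hhol⟩ := HasGoodPoints.exists_holder (a := Q / p) hX.quasiMetric hs has
  have key : ∀ (x : X) (r : ℝ), 0 < r → ∀ (u : X → ℝ) (N : ℝ), 0 < N →
      F (qball ρ x (σ * r)) u < ENNReal.ofReal N →
      ∃ v : X → ℝ, v =ᵐ[μ.restrict (qball ρ x r)] u ∧
        ∀ y ∈ qball ρ x r, ∀ z ∈ qball ρ x r,
          |v y - v z| ≤ C * c ^ (1 / p) * ρ y z ^ (s - Q / p) *
            (r ^ (Q / p) / (μ (qball ρ x (σ * r))).toReal ^ (1 / p)) * N := by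
    intro x r hr u N hN hFN
    have hm := hX.toReal_ball_pos x (mul_pos hσ0 hr)
    obtain ⟨g, ⟨hg, E, hE, hgrad⟩, hgN⟩ :=
      hF _ (hX.nullMeasurableSet_ball x (σ * r) (by positivity)) u _ hFN
    obtain ⟨v, hv1, hv2⟩ := hhol x r _ _ u _ hr (by positivity)
      (hasGoodPoints_of_gradient hX hp0 hc hr hm (hdoub x r hr) hg hE hgrad hN hgN)
    refine ⟨v, ?_, fun y hy z hz => (hv2 y hy z hz).trans_eq (by ring)⟩
    filter_upwards [ae_restrict_ball_notMem hX x hr hE] with y hy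
    exact hv1 y hy.1 ⟨(hdoub x r hr y hy.1 r hr le_rfl).1
      (show ρ y y < r by rwa [hX.quasiMetric.self]), hy.2⟩
  refine ⟨2 * (C * c ^ (1 / p)), by positivity, fun x r hr u hu => ?_⟩
  rcases eq_or_ne (F (qball ρ x (σ * r)) u) 0 with h0 | h0
  · -- the functional vanishes, hence `u` is almost everywhere constant
    have hseq := fun n : ℕ => key x r hr u (1 / ((n : ℝ) + 1)) (by positivity)
      (by rw [h0]; exact ENNReal.ofReal_pos.2 (by positivity))
    choose v hv1 hv2 using hseq
    have hall : ∀ᵐ y ∂μ.restrict (qball ρ x r), y ∈ qball ρ x r ∧ ∀ n, v n y = u y :=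
      (ae_restrict_mem₀ (hX.nullMeasurableSet_ball x r hr)).and (ae_all_iff.2 hv1)
    have hne : μ.restrict (qball ρ x r) ≠ 0 := by
      rw [Ne, Measure.restrict_eq_zero]
      exact (hX.ball_pos x r hr).ne'
    have : (ae (μ.restrict (qball ρ x r))).NeBot := ae_neBot.2 hne
    obtain ⟨y₀, hy₀, hvy₀⟩ := hall.exists
    refine ⟨fun _ => u y₀, ?_, fun y _ z _ => by simp [h0]⟩
    filter_upwards [hall] with y hy
    have hlim := fun n : ℕ => hv2 n y hy.1 y₀ hy₀
    simp only [hy.2, hvy₀] at hlim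
    have ht : Filter.Tendsto (fun n : ℕ => C * c ^ (1 / p) * ρ y y₀ ^ (s - Q / p) *
        (r ^ (Q / p) / (μ (qball ρ x (σ * r))).toReal ^ (1 / p)) * (1 / ((n : ℝ) + 1)))
        Filter.atTop (nhds (C * c ^ (1 / p) * ρ y y₀ ^ (s - Q / p) *
        (r ^ (Q / p) / (μ (qball ρ x (σ * r))).toReal ^ (1 / p)) * 0)) :=
      tendsto_one_div_add_atTop_nhds_zero_nat.const_mul _
    rw [mul_zero] at ht
    have := ge_of_tendsto' ht hlim
    have := abs_nonpos_iff.1 this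
    linarith
  · have hpos := ENNReal.toReal_pos h0 hu.2.ne
    obtain ⟨v, hv1, hv2⟩ := key x r hr u (2 * (F (qball ρ x (σ * r)) u).toReal) (by positivity) (by
      rw [ENNReal.lt_ofReal_iff_toReal_lt hu.2.ne]
      linarith)
    exact ⟨v, hv1, fun y hy z hz => (hv2 y hy z hz).trans_eq (by ring)⟩

/-- Integration of the Hedberg type inequality: a function dominated by `h^{p/P} + 1` belongs to
`L^P` if `h` belongs to `L^p`. -/
theorem eLpNorm_le_of_pointwise {ν : Measure X} {f : X → ℝ} {h : X → ℝ} {P p e Y : ℝ}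
    {M : ℝ≥0∞} (hP : 0 < P) (he : e * P = p) (hY : 0 ≤ Y) (hh : ∀ x, 0 ≤ h x)
    (hf : ∀ᵐ x ∂ν, |f x| ≤ Y * (h x ^ e + 1)) (hhM : ∫⁻ x, ENNReal.ofReal (h x ^ p) ∂ν ≤ M)
    (hν : ν univ ≤ M) :
    eLpNorm f (ENNReal.ofReal P) ν ≤ ENNReal.ofReal (2 * Y) * (2 * M) ^ (1 / P) := by
  rw [eLpNorm_eq_lintegral_rpow_enorm_toReal (ENNReal.ofReal_pos.2 hP).ne' ENNReal.ofReal_ne_top,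
    ENNReal.toReal_ofReal hP.le]
  have hpt : ∀ᵐ x ∂ν, ‖f x‖ₑ ^ P ≤
      ENNReal.ofReal (2 * Y) ^ P * (ENNReal.ofReal (h x ^ p) + 1) := by
    filter_upwards [hf] with x hx
    have h0 : 0 ≤ h x ^ e := Real.rpow_nonneg (hh x) _
    have hmax : h x ^ e + 1 ≤ 2 * max (h x ^ e) 1 := by
      linarith [le_max_left (h x ^ e) 1, le_max_right (h x ^ e) 1]
    have h1 : |f x| ^ P ≤ (2 * Y) ^ P * (h x ^ p + 1) := by
      calc |f x| ^ P ≤ ((2 * Y) * max (h x ^ e) 1) ^ P := by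
            refine Real.rpow_le_rpow (abs_nonneg _) (hx.trans ?_) hP.le
            calc _ ≤ Y * (2 * max (h x ^ e) 1) := by gcongr
              _ = _ := by ring
        _ = (2 * Y) ^ P * (max (h x ^ e) 1) ^ P := Real.mul_rpow (by positivity) (by positivity)
        _ ≤ _ := by
            gcongr
            rcases max_choice (h x ^ e) 1 with hm | hm <;> rw [hm]
            · rw [← Real.rpow_mul (hh x), he]
              linarith
            · rw [Real.one_rpow]
              linarith [Real.rpow_nonneg (hh x) p]
    rw [Real.enorm_eq_ofReal_abs, ENNReal.ofReal_rpow_of_nonneg (abs_nonneg _) hP.le,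
      ENNReal.ofReal_rpow_of_nonneg (by positivity) hP.le, ← ENNReal.ofReal_one,
      ← ENNReal.ofReal_add (Real.rpow_nonneg (hh x) p) zero_le_one,
      ← ENNReal.ofReal_mul (by positivity)]
    exact ENNReal.ofReal_le_ofReal h1
  calc (∫⁻ x, ‖f x‖ₑ ^ P ∂ν) ^ (1 / P)
      ≤ (∫⁻ x, ENNReal.ofReal (2 * Y) ^ P * (ENNReal.ofReal (h x ^ p) + 1) ∂ν) ^ (1 / P) := by
        gcongr ?_ ^ (1 / P)
        exact lintegral_mono_ae hpt
    _ ≤ (ENNReal.ofReal (2 * Y) ^ P * (2 * M)) ^ (1 / P) := by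
        gcongr
        rw [lintegral_const_mul' _ _ (ENNReal.rpow_ne_top_of_nonneg hP.le ENNReal.ofReal_ne_top)]
        gcongr
        rw [lintegral_add_right _ measurable_const, lintegral_one, two_mul]
        gcongr
    _ = _ := by
        rw [ENNReal.mul_rpow_of_nonneg _ _ (by positivity), ← ENNReal.rpow_mul,
          mul_one_div_cancel hP.ne', ENNReal.rpow_one]

theorem le_ofReal_of_forall_gt {L : ℝ≥0∞} {D b V a : ℝ}
    (h : ∀ N, a < N → L ≤ ENNReal.ofReal (D * (b * N + V))) :
    L ≤ ENNReal.ofReal (D * (b * a + V)) := by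
  have hc : Continuous fun N : ℝ => ENNReal.ofReal (D * (b * N + V)) :=
    ENNReal.continuous_ofReal.comp (by fun_prop)
  exact ge_of_tendsto (hc.continuousWithinAt (s := Ioi a) (x := a))
    (Filter.eventually_of_mem self_mem_nhdsWithin fun N hN => h N hN)

theorem ofReal_div_rpow_mul_eq {D b V e : ℝ} (hD : 0 ≤ D) (hb : 0 ≤ b) (hV : 0 ≤ V)
    {M T : ℝ≥0∞} (hM : 0 < M.toReal) (hT : T ≠ ∞) :
    ENNReal.ofReal D / M ^ e * (ENNReal.ofReal b * T + ENNReal.ofReal V) =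
      ENNReal.ofReal (D / M.toReal ^ e * (b * T.toReal + V)) := by
  have hMe : 0 < M.toReal ^ e := Real.rpow_pos_of_pos hM e
  rw [ENNReal.ofReal_mul (p := D / M.toReal ^ e) (by positivity),
    ENNReal.ofReal_add (by positivity) hV, ENNReal.ofReal_mul hb, ENNReal.ofReal_toReal hT,
    ENNReal.ofReal_div_of_pos hMe, ← ENNReal.ofReal_rpow_of_pos hM,
    ENNReal.ofReal_toReal (ENNReal.toReal_pos_iff.1 hM).2.ne]

/-- The common core of the Sobolev and the Sobolev–Poincaré inequality. For every number `N`
exceeding `F(σB)(u)` there is a gradient `g`, with an exceptional set `E`, such that the oscillation of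
`u` satisfies a Hedberg type inequality on `B \ E`, functions dominated by the right-hand side of
this inequality satisfy the expected `L^{p*}` bound, and Chebyshev's inequality holds on `B \ E`. -/
theorem exists_sobolev_core [Nontrivial X] (hX : IsQuasiMetricMeasure ρ μ) {Q σ s p : ℝ}
    (hQ : 0 < Q) (hσ : triConst ρ ≤ σ) (hd : IsQDoubling ρ μ Q) (hs : 0 < s) (hp0 : 0 < p)
    (hp : p < Q / s) {F : Set X → (X → ℝ) → ℝ≥0∞} (hF : DominatesHajlasz ρ μ s p F) :
    ∃ c C C' : ℝ, 1 ≤ c ∧ 0 < C ∧ 0 < C' ∧ ∀ (x : X) (r : ℝ), 0 < r → ∀ (u : X → ℝ) (N : ℝ),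
      0 < N → F (qball ρ x (σ * r)) u < ENNReal.ofReal N →
      ∃ (g : X → ℝ≥0) (h : X → ℝ) (E : Set X), (∀ y, 0 ≤ h y) ∧
        AEMeasurable g (μ.restrict (qball ρ x (σ * r))) ∧
        ∫⁻ z in qball ρ x (σ * r), (g z : ℝ≥0∞) ^ p ∂μ ≤ ENNReal.ofReal (N ^ p) ∧
        (∀ y ∈ qball ρ x r \ E, ∀ z ∈ qball ρ x r \ E, |u y - u z| ≤
          C * (r ^ s * (c ^ (1 / p) * N / (μ (qball ρ x (σ * r))).toReal ^ (1 / p)) * (h y + 1) +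
            r ^ s * g z)) ∧
        (∀ (f : X → ℝ) (Y : ℝ), 0 ≤ Y → (∀ y ∈ qball ρ x r \ E, |f y| ≤ Y * (h y + 1)) →
          eLpNorm f (ENNReal.ofReal (Q * p / (Q - s * p))) (μ.restrict (qball ρ x r)) ≤
            ENNReal.ofReal (C' * Y * (μ (qball ρ x (σ * r))).toReal ^ (1 / p - s / Q))) ∧
        ∀ (f : X → ℝ≥0∞) (I : ℝ), 0 ≤ I → AEMeasurable f (μ.restrict (qball ρ x (σ * r))) →
          ∫⁻ z in qball ρ x (σ * r), f z ∂μ ≤ ENNReal.ofReal I →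
            ∃ z ∈ qball ρ x r \ E,
              f z ≤ ENNReal.ofReal (c * I / (μ (qball ρ x (σ * r))).toReal) := by
  have hsp : s * p < Q := by rwa [lt_div_iff₀ hs, mul_comm] at hp
  have has : s < Q / p := by rwa [lt_div_iff₀ hp0]
  have hsp' : 0 < Q - s * p := by linarith
  have hσ1 : 1 ≤ σ := hX.quasiMetric.one_le_triConst.trans hσ
  have hσ0 : 0 < σ := by linarith
  obtain ⟨c, hc, hdoub⟩ := hd.exists_const hX hσ
  obtain ⟨C, hC, hhed⟩ := HasGoodPoints.exists_hedberg (a := Q / p) hX.quasiMetric hs has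
  set P : ℝ := Q * p / (Q - s * p) with hP
  have hP0 : 0 < P := by positivity
  have hPinv : 1 / P = 1 / p - s / Q := by
    rw [hP]
    field_simp
  refine ⟨c, C, 2 * 2 ^ (1 / P), hc, hC, by positivity, fun x r hr u N hN hFN => ?_⟩
  set A := qball ρ x (σ * r) with hA
  have hm := hX.toReal_ball_pos x (mul_pos hσ0 hr)
  have hBA : qball ρ x r ⊆ A := qball_subset_qball ρ x (le_mul_of_one_le_left hr.le hσ1)
  obtain ⟨g, ⟨hg, E, hE, hgrad⟩, hgN⟩ :=
    hF _ (hX.nullMeasurableSet_ball x (σ * r) (by positivity)) u _ hFN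
  have hgood := hasGoodPoints_of_gradient hX hp0 hc hr hm (hdoub x r hr) hg hE hgrad hN hgN
  rw [ENNReal.ofReal_rpow_of_nonneg hN.le hp0.le] at hgN
  set H : ℝ := c ^ (1 / p) * N / (μ A).toReal ^ (1 / p) with hH
  have hH0 : 0 < H := by positivity
  refine ⟨g, fun y => (g y / H) ^ (1 - s / (Q / p)), E, fun y => by positivity, hg, hgN,
    fun y hy z hz => hhed x r H _ u _ hr hH0 hgood y hy.1 ⟨hBA hy.1, hy.2⟩ z hz.1
      ⟨hBA hz.1, hz.2⟩, fun f Y hY hf => ?_, fun f I hI hfm hfI => ?_⟩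
  · have hBtop : μ A ≠ ∞ := (hX.ball_lt_top x _ (mul_pos hσ0 hr)).ne
    have hint : ∫⁻ y in qball ρ x r, ENNReal.ofReal ((g y / H) ^ p) ∂μ ≤ μ A := by
      have hterm : ∀ y, ENNReal.ofReal ((g y / H) ^ p) =
          ENNReal.ofReal ((H ^ p)⁻¹) * (g y : ℝ≥0∞) ^ p := by
        intro y
        rw [← ENNReal.ofReal_coe_nnreal, ENNReal.ofReal_rpow_of_nonneg (g y).coe_nonneg hp0.le,
          ← ENNReal.ofReal_mul (by positivity), Real.div_rpow (g y).coe_nonneg hH0.le]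
        congr 1
        ring
      simp_rw [hterm]
      rw [lintegral_const_mul' _ _ ENNReal.ofReal_ne_top]
      calc _ ≤ ENNReal.ofReal ((H ^ p)⁻¹) * ENNReal.ofReal (N ^ p) := by
            gcongr
            exact (lintegral_mono_set hBA).trans hgN
        _ = ENNReal.ofReal ((H ^ p)⁻¹ * N ^ p) := (ENNReal.ofReal_mul (by positivity)).symm
        _ ≤ μ A := by
            refine ENNReal.ofReal_le_of_le_toReal ?_
            have hHp : H ^ p = c * N ^ p / (μ A).toReal := by
              rw [hH, Real.div_rpow (by positivity) (by positivity),
                Real.mul_rpow (by positivity) hN.le, ← Real.rpow_mul (by linarith),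
                ← Real.rpow_mul hm.le, one_div_mul_cancel hp0.ne', Real.rpow_one, Real.rpow_one]
            have hNp : 0 < N ^ p := by positivity
            rw [hHp, inv_div, div_mul_eq_mul_div, div_le_iff₀ (by positivity)]
            have : 0 ≤ (c - 1) * ((μ A).toReal * N ^ p) :=
              mul_nonneg (by linarith) (by positivity)
            linarith
    refine (eLpNorm_le_of_pointwise (h := fun y => g y / H) (e := 1 - s / (Q / p)) (M := μ A) hP0 ?_
      hY (fun y => by positivity) ?_ hint ?_).trans_eq ?_
    · rw [hP]
      field_simp
    · filter_upwards [ae_restrict_ball_notMem hX x hr hE] with y hy using hf y hy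
    · rw [Measure.restrict_apply_univ]
      exact measure_mono hBA
    · rw [← ENNReal.ofReal_toReal hBtop, ← ENNReal.ofReal_ofNat 2,
        ← ENNReal.ofReal_mul (by norm_num), ENNReal.ofReal_rpow_of_nonneg (by positivity)
          (by positivity), ← ENNReal.ofReal_mul (by positivity),
        Real.mul_rpow (by norm_num) hm.le, hPinv, ENNReal.toReal_ofReal hm.le]
      congr 1
      ring
  · have hxx : x ∈ qball ρ x r := show ρ x x < r by rwa [hX.quasiMetric.self]
    obtain ⟨hsub, hle⟩ := hdoub x r hr x hxx r hr le_rfl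
    rw [div_self hr.ne', Real.one_rpow] at hle
    obtain ⟨z, hz, hz1, hz2⟩ :=
      exists_le_of_lintegral_le hX hr one_pos hI hsub hm hle hE hfm hfI
    exact ⟨z, ⟨hz1, hz.2⟩, by simpa using hz2⟩

theorem localSobolevPoincare_of_isQDoubling [Nontrivial X] (hX : IsQuasiMetricMeasure ρ μ)
    {Q σ s p : ℝ} (hQ : 0 < Q) (hσ : triConst ρ ≤ σ) (hd : IsQDoubling ρ μ Q) (hs : 0 < s)
    (hp0 : 0 < p) (hp : p < Q / s) {F : Set X → (X → ℝ) → ℝ≥0∞}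
    (hF : DominatesHajlasz ρ μ s p F) : LocalSobolevPoincare ρ μ F Q s σ p := by
  have hσ0 : 0 < σ := by linarith [hX.quasiMetric.one_le_triConst]
  obtain ⟨c, C, C', hc, hC, hC', hcore⟩ := exists_sobolev_core hX hQ hσ hd hs hp0 hp hF
  refine ⟨C' * (2 * C * c ^ (1 / p)), by positivity, fun x r hr u hu => ?_⟩
  have hm := hX.toReal_ball_pos x (mul_pos hσ0 hr)
  have hmtop := (hX.ball_lt_top x _ (mul_pos hσ0 hr)).ne
  set m := (μ (qball ρ x (σ * r))).toReal with hmdef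
  have hrhs := ofReal_div_rpow_mul_eq (D := C' * (2 * C * c ^ (1 / p))) (b := r ^ s) (e := s / Q)
    (by positivity) (by positivity) le_rfl hm hu.2.ne
  rw [ENNReal.ofReal_zero, add_zero] at hrhs
  rw [hrhs, ← hmdef]
  refine le_ofReal_of_forall_gt fun N hN => ?_
  have hN0 : 0 < N := ENNReal.toReal_nonneg.trans_lt hN
  obtain ⟨g, h, E, hh, hg, hgN, hosc, hnorm, hcheb⟩ := hcore x r hr u N hN0
    ((ENNReal.lt_ofReal_iff_toReal_lt hu.2.ne).2 hN)
  obtain ⟨z, hz, hgz⟩ := hcheb _ (N ^ p) (by positivity) (hg.coe_nnreal_ennreal.pow_const p) hgN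
  rw [← ENNReal.ofReal_coe_nnreal, ENNReal.ofReal_rpow_of_nonneg (g z).coe_nonneg hp0.le,
    ENNReal.ofReal_le_ofReal_iff (by positivity)] at hgz
  set H : ℝ := c ^ (1 / p) * N / m ^ (1 / p) with hH
  have hH0 : 0 < H := by positivity
  have hgz' : (g z : ℝ) ≤ H := by
    have := le_rpow_mul_of_rpow_le (c := c) (N := N) (e := 1) (a := 1) hp0 (by linarith) hN0.le hm one_pos
      (g z).coe_nonneg (by simpa using hgz)
    simpa [hH] using this
  refine (iInf_le _ (u z)).trans ((hnorm (fun y => u y - u z) (2 * C * (r ^ s * H))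
    (by positivity) fun y hy => (hosc y hy z hz).trans ?_).trans_eq ?_)
  · have h1 := hh y
    have h2 : r ^ s * (g z : ℝ) ≤ r ^ s * H * (h y + 1) := by
      calc r ^ s * (g z : ℝ) ≤ r ^ s * H * 1 := by rw [mul_one]; gcongr
        _ ≤ _ := by gcongr; linarith
    calc _ ≤ C * (r ^ s * H * (h y + 1) + r ^ s * H * (h y + 1)) := by gcongr
      _ = _ := by ring
  · congr 1
    rw [hH, Real.rpow_sub hm]
    field_simp
    ring

theorem localSobolev_of_isQDoubling [Nontrivial X] (hX : IsQuasiMetricMeasure ρ μ)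
    {Q σ s p : ℝ} (hQ : 0 < Q) (hσ : triConst ρ ≤ σ) (hd : IsQDoubling ρ μ Q) (hs : 0 < s)
    (hp0 : 0 < p) (hp : p < Q / s) {F : Set X → (X → ℝ) → ℝ≥0∞}
    (hF : DominatesHajlasz ρ μ s p F) : LocalSobolev ρ μ F Q s σ p := by
  have hσ0 : 0 < σ := by linarith [hX.quasiMetric.one_le_triConst]
  obtain ⟨c, C, C', hc, hC, hC', hcore⟩ := exists_sobolev_core hX hQ hσ hd hs hp0 hp hF
  refine ⟨C' * ((1 + 2 * C) * (2 * c) ^ (1 / p)), by positivity, fun x r hr u hu => ?_⟩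
  have hm := hX.toReal_ball_pos x (mul_pos hσ0 hr)
  have hmtop := (hX.ball_lt_top x _ (mul_pos hσ0 hr)).ne
  have hpE : ENNReal.ofReal p ≠ 0 := (ENNReal.ofReal_pos.2 hp0).ne'
  rcases eq_or_ne (eLpNorm u (ENNReal.ofReal p) (μ.restrict (qball ρ x (σ * r)))) ∞ with hV | hV
  · rw [hV, add_top, ENNReal.mul_top]
    · exact le_top
    · refine (ENNReal.div_pos (ENNReal.ofReal_pos.2 (by positivity)).ne' ?_).ne'
      exact ENNReal.rpow_ne_top_of_nonneg (by positivity) hmtop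
  have hVint : ∫⁻ y in qball ρ x (σ * r), ‖u y‖ₑ ^ p ∂μ =
      eLpNorm u (ENNReal.ofReal p) (μ.restrict (qball ρ x (σ * r))) ^ p := by
    rw [eLpNorm_eq_lintegral_rpow_enorm_toReal hpE ENNReal.ofReal_ne_top,
      ENNReal.toReal_ofReal hp0.le, ← ENNReal.rpow_mul, one_div_mul_cancel hp0.ne',
      ENNReal.rpow_one]
  set V := (eLpNorm u (ENNReal.ofReal p) (μ.restrict (qball ρ x (σ * r)))).toReal with hVdef
  have hV0 : 0 ≤ V := ENNReal.toReal_nonneg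
  rw [← ENNReal.ofReal_toReal hV, ← hVdef] at hVint ⊢
  set m := (μ (qball ρ x (σ * r))).toReal with hmdef
  rw [ofReal_div_rpow_mul_eq (by positivity) (by positivity) hV0 hm hu.2.ne, ← hmdef]
  refine le_ofReal_of_forall_gt fun N hN => ?_
  have hN0 : 0 < N := ENNReal.toReal_nonneg.trans_lt hN
  obtain ⟨g, h, E, hh, hg, hgN, hosc, hnorm, hcheb⟩ := hcore x r hr u N hN0
    ((ENNReal.lt_ofReal_iff_toReal_lt hu.2.ne).2 hN)
  set Z : ℝ := r ^ s * N + V with hZ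
  have hrs : 0 < r ^ s := by positivity
  have hZ0 : 0 < Z := by positivity
  -- one point controls both `g` and `u`
  have hint : ∫⁻ y in qball ρ x (σ * r),
      (ENNReal.ofReal ((r ^ s) ^ p) * (g y : ℝ≥0∞) ^ p + ‖u y‖ₑ ^ p) ∂μ ≤
      ENNReal.ofReal (2 * Z ^ p) := by
    rw [lintegral_add_left' ((hg.coe_nnreal_ennreal.pow_const p).const_mul _),
      lintegral_const_mul' _ _ ENNReal.ofReal_ne_top, hVint,
      ENNReal.ofReal_rpow_of_nonneg hV0 hp0.le]
    calc _ ≤ ENNReal.ofReal ((r ^ s) ^ p) * ENNReal.ofReal (N ^ p) + ENNReal.ofReal (V ^ p) := by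
          gcongr
      _ = ENNReal.ofReal ((r ^ s * N) ^ p + V ^ p) := by
          rw [Real.mul_rpow hrs.le hN0.le, ← ENNReal.ofReal_mul (by positivity),
            ← ENNReal.ofReal_add (by positivity) (by positivity)]
      _ ≤ _ := by
          refine ENNReal.ofReal_le_ofReal ?_
          have h1 : (r ^ s * N) ^ p ≤ Z ^ p :=
            Real.rpow_le_rpow (by positivity) (by linarith) hp0.le
          have h2 : V ^ p ≤ Z ^ p :=
            Real.rpow_le_rpow hV0 (by linarith [mul_pos hrs hN0]) hp0.le
          linarith
  obtain ⟨z, hz, hfz⟩ := hcheb _ (2 * Z ^ p) (by positivity)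
    (((hg.coe_nnreal_ennreal.pow_const p).const_mul _).add (hu.1.enorm.pow_const p)) hint
  simp only [Pi.add_apply] at hfz
  rw [← ENNReal.ofReal_coe_nnreal, ENNReal.ofReal_rpow_of_nonneg (g z).coe_nonneg hp0.le,
    Real.enorm_eq_ofReal_abs, ENNReal.ofReal_rpow_of_nonneg (abs_nonneg _) hp0.le,
    ← ENNReal.ofReal_mul (by positivity), ← ENNReal.ofReal_add (by positivity) (by positivity),
    ENNReal.ofReal_le_ofReal_iff (by positivity),
    ← Real.mul_rpow hrs.le (g z).coe_nonneg] at hfz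
  set T : ℝ := (2 * c) ^ (1 / p) * Z / m ^ (1 / p) with hT
  have hT0 : 0 < T := by positivity
  have hT' : ∀ b : ℝ, 0 ≤ b → b ^ p ≤ c * (2 * Z ^ p) / m → b ≤ T := by
    intro b hb hbp
    have := le_rpow_mul_of_rpow_le (c := 2 * c) (N := Z) (e := 1) (a := 1) hp0 (by linarith) hZ0.le hm
      one_pos hb (hbp.trans_eq (by simp only [Real.one_rpow]; ring))
    simpa [hT] using this
  have hgz : r ^ s * (g z : ℝ) ≤ T := hT' _ (by positivity) (by
    have : 0 ≤ |u z| ^ p := by positivity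
    linarith)
  have huz : |u z| ≤ T := hT' _ (abs_nonneg _) (by
    have : 0 ≤ (r ^ s * (g z : ℝ)) ^ p := by positivity
    linarith)
  have hHT : r ^ s * (c ^ (1 / p) * N / m ^ (1 / p)) ≤ T := by
    have h1 : c ^ (1 / p) ≤ (2 * c) ^ (1 / p) :=
      Real.rpow_le_rpow (by positivity) (by linarith) (by positivity)
    calc _ = c ^ (1 / p) * (r ^ s * N) / m ^ (1 / p) := by ring
      _ ≤ (2 * c) ^ (1 / p) * Z / m ^ (1 / p) := by gcongr; linarith
  refine (hnorm u ((1 + 2 * C) * T) (by positivity) fun y hy => ?_).trans_eq ?_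
  · have h1 := hh y
    have h2 := hosc y hy z hz
    have h3 : T ≤ T * (h y + 1) := le_mul_of_one_le_right hT0.le (by linarith)
    calc |u y| ≤ |u z| + |u y - u z| := by
          have := abs_add_le (u z) (u y - u z)
          simpa using this
      _ ≤ T * (h y + 1) + C * (T * (h y + 1) + T * (h y + 1)) := by
          exact add_le_add (huz.trans h3) (h2.trans (mul_le_mul_of_nonneg_left (add_le_add
            (mul_le_mul_of_nonneg_right hHT (by linarith)) (hgz.trans h3)) hC.le))
      _ = _ := by ring
  · congr 1
    rw [hT, Real.rpow_sub hm]
    field_simp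

end

/-! ### From the embeddings to the doubling property -/

/-- A sequence which stays away from zero cannot satisfy a superlinear recursion unless its first
term is large: otherwise it would decay geometrically with ratio `Λ^{-1/(α-1)}`. -/
theorem exists_le_of_superlinear_recursion {A Λ α : ℝ} (hA : 0 < A) (hΛ : 1 < Λ) (hα : 1 < α) :
    ∃ δ : ℝ, 0 < δ ∧ ∀ (a : ℕ → ℝ) (l : ℝ), 0 < l → (∀ j, l ≤ a j) →
      (∀ j, a (j + 1) ≤ A * Λ ^ j * a j ^ α) → δ ≤ a 0 := by
  have hα' : 0 < α - 1 := by linarith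
  set θ : ℝ := Λ ^ (-(1 / (α - 1))) with hθ
  have hθ0 : 0 < θ := by positivity
  have hθ1 : θ < 1 := Real.rpow_lt_one_of_one_lt_of_neg hΛ (by simp [hα'])
  have hθΛ : Λ * θ ^ α = θ := by
    have h1 : θ ^ α = θ ^ (α - 1) * θ := by
      nth_rewrite 3 [← Real.rpow_one θ]
      rw [← Real.rpow_add hθ0]
      congr 1
      ring
    have h2 : θ ^ (α - 1) = Λ⁻¹ := by
      rw [hθ, ← Real.rpow_mul (by linarith), neg_mul, one_div_mul_cancel hα'.ne',
        Real.rpow_neg_one]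
    rw [h1, h2]
    field_simp
  refine ⟨(θ / A) ^ (1 / (α - 1)), by positivity, fun a l hl hla hrec => ?_⟩
  by_contra! hlt
  have ha0 : 0 < a 0 := hl.trans_le (hla 0)
  have hsmall : A * a 0 ^ α ≤ θ * a 0 := by
    have h1 : a 0 ^ (α - 1) ≤ θ / A := by
      calc _ ≤ ((θ / A) ^ (1 / (α - 1))) ^ (α - 1) :=
            Real.rpow_le_rpow ha0.le hlt.le hα'.le
        _ = θ / A := by
            rw [← Real.rpow_mul (by positivity), one_div_mul_cancel hα'.ne', Real.rpow_one]
    rw [le_div_iff₀ hA] at h1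
    have h2 : a 0 ^ α = a 0 ^ (α - 1) * a 0 := by
      nth_rewrite 3 [← Real.rpow_one (a 0)]
      rw [← Real.rpow_add ha0]
      congr 1
      ring
    rw [h2]
    calc _ = a 0 ^ (α - 1) * A * a 0 := by ring
      _ ≤ _ := by gcongr
  have hdecay : ∀ j, a j ≤ a 0 * θ ^ j := by
    intro j
    induction j with
    | zero => simp
    | succ j ih =>
      have h1 : a j ^ α ≤ a 0 ^ α * (θ ^ α) ^ j := by
        calc a j ^ α ≤ (a 0 * θ ^ j) ^ α :=
              Real.rpow_le_rpow (hl.le.trans (hla j)) ih (by linarith)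
          _ = _ := by
            rw [Real.mul_rpow ha0.le (by positivity), ← Real.rpow_natCast, ← Real.rpow_natCast,
              ← Real.rpow_mul hθ0.le, ← Real.rpow_mul hθ0.le, mul_comm α]
      calc a (j + 1) ≤ A * Λ ^ j * a j ^ α := hrec j
        _ ≤ A * Λ ^ j * (a 0 ^ α * (θ ^ α) ^ j) := by gcongr
        _ = (A * a 0 ^ α) * (Λ * θ ^ α) ^ j := by rw [mul_pow]; ring
        _ ≤ (θ * a 0) * θ ^ j := by rw [hθΛ]; gcongr
        _ = _ := by ring
  have hlim : Filter.Tendsto (fun j : ℕ => a 0 * θ ^ j) Filter.atTop (nhds (a 0 * 0)) :=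
    (tendsto_pow_atTop_nhds_zero_of_lt_one hθ0.le hθ1).const_mul _
  have := ge_of_tendsto' hlim fun j => (hla j).trans (hdecay j)
  linarith

section

variable {X : Type*} [MeasurableSpace X] {ρ : X → X → ℝ} {μ : Measure X}

/-- `u` is a bump function: it has values in `[0, 1]`, it is Hölder continuous of order `β` with constant `L`, equal to one on
`V`, and it vanishes outside `U`. -/
structure IsBump (ρ : X → X → ℝ) (β L : ℝ) (U V : Set X) (u : X → ℝ) : Prop where
  measurableSet_supp : MeasurableSet U
  measurableSet_one : MeasurableSet V
  measurable : Measurable u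
  mem_Icc : ∀ x, 0 ≤ u x ∧ u x ≤ 1
  eq_one : ∀ x ∈ V, u x = 1
  eq_zero : ∀ x ∉ U, u x = 0
  holder : ∀ y z, |u y - u z| ≤ L * ρ y z ^ β

theorem exists_pos_mul_rpow_lt {c β ε : ℝ} (hc : 0 < c) (hβ : 0 < β) (hε : 0 < ε) :
    ∃ t : ℝ, 0 < t ∧ ∀ a : ℝ, 0 ≤ a → a < t → c * a ^ β < ε := by
  refine ⟨(ε / c) ^ (1 / β), by positivity, fun a ha hat => ?_⟩
  have h1 : a ^ β < ((ε / c) ^ (1 / β)) ^ β := Real.rpow_lt_rpow ha hat hβ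
  rw [← Real.rpow_mul (by positivity), one_div_mul_cancel hβ.ne', Real.rpow_one,
    lt_div_iff₀ hc] at h1
  linarith

theorem exists_ball_subset_of_holder {X : Type*} {ρ : X → X → ℝ} (hρ : IsQuasiMetric ρ) {c β : ℝ} (hc : 0 < c) (hβ : 0 < β)
    {δ : X → ℝ} (hδ : ∀ y z, |δ y - δ z| ≤ c * ρ y z ^ β) (z : X) {ε : ℝ} (hε : 0 < ε) :
    ∃ t : ℝ, 0 < t ∧ ∀ w ∈ qball ρ z t, |δ z - δ w| < ε := by
  obtain ⟨t, ht, h⟩ := exists_pos_mul_rpow_lt hc hβ hε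
  exact ⟨t, ht, fun w hw => (hδ z w).trans_lt (h _ (hρ.nonneg _ _) hw)⟩

theorem IsQuasiMetricMeasure.measurable_of_holder (hX : IsQuasiMetricMeasure ρ μ) {c β : ℝ}
    (hc : 0 < c) (hβ : 0 < β) {δ : X → ℝ} (hδ : ∀ y z, |δ y - δ z| ≤ c * ρ y z ^ β) :
    Measurable δ := by
  refine measurable_of_Iio fun a => hX.measurableSet_of_open _ fun z hz => ?_
  have hz' : δ z < a := hz
  obtain ⟨t, ht, h⟩ := exists_ball_subset_of_holder hX.quasiMetric hc hβ hδ z (sub_pos.2 hz')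
  refine ⟨t, ht, fun w hw => ?_⟩
  have := (abs_lt.1 (h w hw)).1
  show δ w < a
  linarith

/-- Truncating a regular distance function produces bump functions. -/
theorem exists_isBump (hX : IsQuasiMetricMeasure ρ μ) {c β : ℝ} (hc : 0 < c) (hβ : 0 < β)
    {δ : X → ℝ} (hδ : ∀ y z, |δ y - δ z| ≤ c * ρ y z ^ β) {a b : ℝ} (hab : a < b) :
    ∃ u : X → ℝ, IsBump ρ β (c / (b - a)) {z | δ z < b} {z | δ z < a} u := by
  have hm := hX.measurable_of_holder hc hβ hδ
  have hba : 0 < b - a := sub_pos.2 hab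
  refine ⟨fun z => max 0 (min 1 ((b - δ z) / (b - a))), measurableSet_lt hm measurable_const,
    measurableSet_lt hm measurable_const, by fun_prop, fun x => ⟨le_max_left _ _,
      max_le zero_le_one (min_le_left _ _)⟩, fun x hx => ?_, fun x hx => ?_, fun y z => ?_⟩
  · have hx' : δ x < a := hx
    have : 1 ≤ (b - δ x) / (b - a) := (one_le_div hba).2 (by linarith)
    simp [this]
  · have hx' : b ≤ δ x := not_lt.1 hx
    have : (b - δ x) / (b - a) ≤ 0 := div_nonpos_of_nonpos_of_nonneg (by linarith) hba.le
    exact max_eq_left ((min_le_right _ _).trans this)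
  · calc |max 0 (min 1 ((b - δ y) / (b - a))) - max 0 (min 1 ((b - δ z) / (b - a)))|
        ≤ |(b - δ y) / (b - a) - (b - δ z) / (b - a)| := by
          refine (abs_max_sub_max_le_max _ _ _ _).trans ?_
          simp only [sub_self, abs_zero]
          refine max_le (abs_nonneg _) ((abs_min_sub_min_le_max _ _ _ _).trans ?_)
          simp
      _ = |δ y - δ z| / (b - a) := by
          rw [← sub_div, abs_div, abs_of_pos hba, abs_sub_comm]
          congr 2
          ring
      _ ≤ c * ρ y z ^ β / (b - a) := by gcongr; exact hδ y z
      _ = _ := by ring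

theorem mul_rpow_le_eLpNorm {P : ℝ} (hP : 0 < P) {B V : Set X} (hV : NullMeasurableSet V μ)
    (hVB : V ⊆ B) {f : X → ℝ} {b : ℝ} (hb : 0 ≤ b) (hf : ∀ x ∈ V, b ≤ |f x|) :
    ENNReal.ofReal b * μ V ^ (1 / P) ≤ eLpNorm f (ENNReal.ofReal P) (μ.restrict B) := by
  have hind : eLpNorm (V.indicator fun _ => b) (ENNReal.ofReal P) (μ.restrict B) =
      ENNReal.ofReal b * μ V ^ (1 / P) := by
    rw [eLpNorm_indicator_const₀ (hV.mono_ac Measure.restrict_le_self.absolutelyContinuous)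
      (ENNReal.ofReal_pos.2 hP).ne' ENNReal.ofReal_ne_top, ENNReal.toReal_ofReal hP.le,
      Measure.restrict_eq_self _ hVB, Real.enorm_of_nonneg hb]
  rw [← hind]
  refine eLpNorm_mono fun x => ?_
  by_cases hx : x ∈ V
  · simpa [hx, abs_of_nonneg hb] using hf x hx
  · simp [hx]

/-- The self-improving argument: an inequality for bump functions which gains integrability,
applied to bump functions on a decreasing sequence of neighbourhoods of `x`, bounds the measure
of `B(x, r)` from below. -/
theorem isQDoubling_of_bump_inequality (hX : IsQuasiMetricMeasure ρ μ) {Q s p P β D : ℝ}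
    (hQ : 0 < Q) (hs : 0 < s) (hp : 0 < p) (hP : 0 < P) (hpP : 1 / P = 1 / p - s / Q)
    (hβ : 0 < β) (hreg : HasRegularDistances ρ β) (hD : 0 < D)
    (hbump : ∀ (y : X) (R L : ℝ) (U V : Set X) (u : X → ℝ), 0 < R → 0 < L → IsBump ρ β L U V u →
      V ⊆ U → U ⊆ qball ρ y R → 2 * μ U ≤ μ (qball ρ y R) →
      μ V ^ (1 / P) ≤ ENNReal.ofReal (D * (R ^ s * L ^ (s / β) + 1)) /
        μ (qball ρ y R) ^ (s / Q) * μ U ^ (1 / p)) : IsQDoubling ρ μ Q := by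
  obtain ⟨c, hc, hreg⟩ := hreg
  have hc0 : 0 < c := by linarith
  have hsβ : 0 < s / β := by positivity
  have hPp : p < P := by
    have : 1 / P < 1 / p := by rw [hpP]; linarith [div_pos hs hQ]
    exact (one_div_lt_one_div hP hp).1 this
  set D' : ℝ := 2 * D * (4 * c ^ 2) ^ (s / β) with hD'
  have hD'0 : 0 < D' := by positivity
  obtain ⟨δ₀, hδ₀, hiter⟩ := exists_le_of_superlinear_recursion (A := D' ^ P)
    (Λ := ((2 : ℝ) ^ (s / β)) ^ P) (α := P / p) (by positivity)
    (Real.one_lt_rpow (Real.one_lt_rpow (by norm_num) hsβ) hP) ((one_lt_div hp).2 hPp)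
  refine ⟨min δ₀ (1 / 2), by positivity, fun x y r R hr hrR hsub => ?_⟩
  have hR : 0 < R := hr.trans_le hrR
  obtain ⟨δ, hδ1, hδ2, hδ3⟩ := hreg x
  have hM := hX.toReal_ball_pos y hR
  have hMtop := (hX.ball_lt_top y R hR).ne
  set M := (μ (qball ρ y R)).toReal with hMdef
  set t : ℝ := r ^ β / c with ht
  have ht0 : 0 < t := by positivity
  let τ : ℕ → ℝ := fun j => t / 2 * (1 + (1 / 2) ^ j)
  let U : ℕ → Set X := fun j => {z | δ z < τ j}
  have hτ : ∀ j, τ j - τ (j + 1) = t / 4 * (1 / 2) ^ j := fun j => by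
    simp only [τ, pow_succ]
    ring
  have hτlt : ∀ j, τ (j + 1) < τ j := fun j => by
    have : 0 < t / 4 * (1 / 2) ^ j := by positivity
    linarith [hτ j]
  have hanti : Antitone τ := antitone_nat_of_succ_le fun j => (hτlt j).le
  have hU0 : U 0 ⊆ qball ρ x r := by
    intro z hz
    have hz' : δ z < t := by
      have : δ z < t / 2 * (1 + (1 / 2) ^ 0) := hz
      norm_num at this
      linarith
    have h1 : ρ x z ^ β < r ^ β := by
      calc _ ≤ c * δ z := hδ1 z
        _ < c * t := by gcongr
        _ = r ^ β := by rw [ht]; field_simp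
    exact (Real.rpow_lt_rpow_iff (hX.quasiMetric.nonneg _ _) hr.le hβ).1 h1
  have hUj : ∀ j, U j ⊆ U 0 := fun j z hz => lt_of_lt_of_le hz (hanti (Nat.zero_le j))
  have hUB : ∀ j, U j ⊆ qball ρ y R := fun j => (hUj j).trans (hU0.trans hsub)
  have hUtop : ∀ j, μ (U j) ≠ ∞ := fun j => ((measure_mono (hUB j)).trans_lt
    (hX.ball_lt_top y R hR)).ne
  -- it suffices to bound `μ (U 0)` from below
  suffices hmain : min δ₀ (1 / 2) * (r / R) ^ Q * M ≤ (μ (U 0)).toReal by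
    rw [ENNReal.le_div_iff_mul_le (Or.inl (hX.ball_pos y R hR).ne') (Or.inl hMtop),
      ← ENNReal.ofReal_toReal hMtop, ← ENNReal.ofReal_mul (by positivity)]
    exact (ENNReal.ofReal_le_of_le_toReal hmain).trans (measure_mono hU0)
  have hrRQ : (r / R) ^ Q ≤ 1 :=
    Real.rpow_le_one (by positivity) ((div_le_one hR).2 hrR) hQ.le
  by_cases hhalf : 2 * μ (U 0) ≤ μ (qball ρ y R)
  swap
  · have h1 : M ≤ 2 * (μ (U 0)).toReal := by
      have := ENNReal.toReal_mono (by finiteness [hUtop 0]) (not_le.1 hhalf).le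
      simpa using this
    calc _ ≤ 1 / 2 * 1 * M := by gcongr; exact min_le_right _ _
      _ ≤ _ := by linarith
  obtain ⟨ε, hε, hball⟩ := exists_ball_subset_of_holder hX.quasiMetric hc0 hβ hδ3 x
    (half_pos ht0)
  have hδx : δ x ≤ 0 := by
    have := hδ2 x
    rwa [hX.quasiMetric.self, Real.zero_rpow hβ.ne', mul_zero] at this
  have hballU : ∀ j, qball ρ x ε ⊆ U j := by
    intro j z hz
    have h1 := (abs_lt.1 (hball z hz)).1
    have h2 : t / 2 ≤ τ j := le_mul_of_one_le_right (by positivity) (by simp)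
    show δ z < τ j
    linarith
  have hrec : ∀ j, (μ (U (j + 1))).toReal ^ (1 / P) ≤
      D' * (2 ^ (s / β)) ^ j * (R / r) ^ s / M ^ (s / Q) * (μ (U j)).toReal ^ (1 / p) := by
    intro j
    obtain ⟨u, hu⟩ := exists_isBump hX hc0 hβ hδ3 (hτlt j)
    have hL : c / (τ j - τ (j + 1)) = 4 * c ^ 2 * 2 ^ j / r ^ β := by
      rw [hτ, ht, one_div, inv_pow]
      field_simp
    rw [hL] at hu
    have h1 := hbump y R _ _ _ u hR (by positivity) hu
      (fun z hz => lt_trans hz (hτlt j)) (hUB j)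
      (le_trans (by gcongr; exact hUj j) hhalf)
    have hLs : (4 * c ^ 2 * 2 ^ j / r ^ β) ^ (s / β) =
        (4 * c ^ 2) ^ (s / β) * (2 ^ (s / β)) ^ j / r ^ s := by
      rw [Real.div_rpow (by positivity) (by positivity), Real.mul_rpow (by positivity)
        (by positivity), ← Real.rpow_mul hr.le, mul_div_cancel₀ _ hβ.ne', Real.rpow_pow_comm (by norm_num)]
    have hD1 : D * (R ^ s * (4 * c ^ 2 * 2 ^ j / r ^ β) ^ (s / β) + 1) ≤
        D' * (2 ^ (s / β)) ^ j * (R / r) ^ s := by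
      have h2 : R ^ s * (4 * c ^ 2 * 2 ^ j / r ^ β) ^ (s / β) =
          (4 * c ^ 2) ^ (s / β) * (2 ^ (s / β)) ^ j * (R / r) ^ s := by
        rw [hLs, Real.div_rpow hR.le hr.le]
        ring
      have h3 : (1 : ℝ) ≤ (4 * c ^ 2) ^ (s / β) * (2 ^ (s / β)) ^ j * (R / r) ^ s := by
        refine one_le_mul_of_one_le_of_one_le (one_le_mul_of_one_le_of_one_le ?_ ?_) ?_
        · exact Real.one_le_rpow (by nlinarith) hsβ.le
        · exact one_le_pow₀ (Real.one_le_rpow (by norm_num) hsβ.le)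
        · exact Real.one_le_rpow ((one_le_div hr).2 hrR) hs.le
      rw [h2]
      calc _ ≤ D * ((4 * c ^ 2) ^ (s / β) * (2 ^ (s / β)) ^ j * (R / r) ^ s +
            (4 * c ^ 2) ^ (s / β) * (2 ^ (s / β)) ^ j * (R / r) ^ s) := by gcongr
        _ = _ := by rw [hD']; ring
    have h4 : μ (U (j + 1)) ^ (1 / P) ≤ ENNReal.ofReal (D' * (2 ^ (s / β)) ^ j * (R / r) ^ s) /
        μ (qball ρ y R) ^ (s / Q) * μ (U j) ^ (1 / p) := h1.trans (by gcongr)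
    have h5 := ENNReal.toReal_mono ?_ h4
    · rw [ENNReal.toReal_mul, ENNReal.toReal_div, ENNReal.toReal_ofReal (by positivity),
        ← ENNReal.toReal_rpow, ← ENNReal.toReal_rpow, ← ENNReal.toReal_rpow] at h5
      exact h5
    · refine ENNReal.mul_ne_top (ENNReal.div_ne_top ENNReal.ofReal_ne_top ?_)
        (ENNReal.rpow_ne_top_of_nonneg (by positivity) (hUtop j))
      exact (ENNReal.rpow_pos (hX.ball_pos y R hR) hMtop).ne'
  have hRr : 0 < R / r := by positivity
  -- the normalized measures satisfy a scale-free recursion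
  have hfin := hiter (fun j => (μ (U j)).toReal / M * (R / r) ^ Q)
    ((μ (qball ρ x ε)).toReal / M * (R / r) ^ Q) (by
      have := hX.toReal_ball_pos x hε
      positivity) (fun j => by
      have := ENNReal.toReal_mono (hUtop j) (measure_mono (hballU j))
      gcongr) (fun j => by
      have hm0 : 0 ≤ (μ (U j)).toReal := ENNReal.toReal_nonneg
      have hm1 : 0 ≤ (μ (U (j + 1))).toReal := ENNReal.toReal_nonneg
      have hkey : ((μ (U (j + 1))).toReal / M * (R / r) ^ Q) ^ (1 / P) ≤
          D' * (2 ^ (s / β)) ^ j * ((μ (U j)).toReal / M * (R / r) ^ Q) ^ (1 / p) := by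
        rw [Real.mul_rpow (by positivity) (by positivity),
          Real.mul_rpow (by positivity) (by positivity), Real.div_rpow hm0 hM.le,
          Real.div_rpow hm1 hM.le, ← Real.rpow_mul hRr.le, ← Real.rpow_mul hRr.le]
        have e1 : M ^ (1 / p) = M ^ (1 / P) * M ^ (s / Q) := by
          rw [← Real.rpow_add hM, hpP]
          congr 1
          ring
        have e2 : (R / r) ^ (Q * (1 / p)) = (R / r) ^ (Q * (1 / P)) * (R / r) ^ s := by
          rw [← Real.rpow_add hRr, hpP]
          congr 1
          field_simp
          ring
        rw [e1, e2]
        calc _ ≤ D' * (2 ^ (s / β)) ^ j * (R / r) ^ s / M ^ (s / Q) *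
              (μ (U j)).toReal ^ (1 / p) / M ^ (1 / P) * (R / r) ^ (Q * (1 / P)) := by
              gcongr
              exact hrec j
          _ = _ := by
              field_simp
      have := Real.rpow_le_rpow (by positivity) hkey hP.le
      rw [← Real.rpow_mul (by positivity), one_div_mul_cancel hP.ne', Real.rpow_one,
        Real.mul_rpow (by positivity) (by positivity), Real.mul_rpow (by positivity)
        (by positivity), ← Real.rpow_mul (by positivity)] at this
      refine this.trans_eq ?_
      congr 2
      · exact (Real.rpow_pow_comm (by positivity) _ _).symm
      · ring)
  have hinv : (R / r) ^ Q * (r / R) ^ Q = 1 := by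
    rw [← Real.mul_rpow hRr.le (by positivity)]
    have : R / r * (r / R) = 1 := by field_simp
    rw [this, Real.one_rpow]
  calc min δ₀ (1 / 2) * (r / R) ^ Q * M ≤ δ₀ * (r / R) ^ Q * M := by
        gcongr
        exact min_le_left _ _
    _ ≤ ((μ (U 0)).toReal / M * (R / r) ^ Q) * (r / R) ^ Q * M := by gcongr
    _ = (μ (U 0)).toReal * ((R / r) ^ Q * (r / R) ^ Q) := by field_simp
    _ = _ := by rw [hinv, mul_one]

theorem IsBump.eLpNorm_le {β L : ℝ} {U V : Set X} {u : X → ℝ} (hu : IsBump ρ β L U V u) {p : ℝ}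
    (hp : 0 < p) (A : Set X) :
    eLpNorm u (ENNReal.ofReal p) (μ.restrict A) ≤ μ U ^ (1 / p) := by
  calc eLpNorm u (ENNReal.ofReal p) (μ.restrict A)
      ≤ eLpNorm (U.indicator fun _ => (1 : ℝ)) (ENNReal.ofReal p) (μ.restrict A) := by
        refine eLpNorm_mono fun x => ?_
        by_cases hx : x ∈ U
        · simpa [hx, abs_of_nonneg (hu.mem_Icc x).1] using (hu.mem_Icc x).2
        · simp [hx, hu.eq_zero x hx]
    _ = (μ.restrict A U) ^ (1 / p) := by
        rw [eLpNorm_indicator_const hu.measurableSet_supp (ENNReal.ofReal_pos.2 hp).ne'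
          ENNReal.ofReal_ne_top, ENNReal.toReal_ofReal hp.le]
        simp
    _ ≤ _ := by
        exact ENNReal.rpow_le_rpow (Measure.restrict_apply_le _ _) (by positivity)

theorem IsBump.memHom {s p β L K : ℝ} (hp : 0 < p) {A U V : Set X} {u : X → ℝ}
    (hu : IsBump ρ β L U V u) {F : Set X → (X → ℝ) → ℝ≥0∞} (hU : μ U ≠ ∞)
    (hF : F A u ≤ ENNReal.ofReal (K * L ^ (s / β)) * μ U ^ (1 / p)) : MemHom μ F A u :=
  ⟨hu.measurable.aemeasurable, hF.trans_lt (ENNReal.mul_lt_top ENNReal.ofReal_lt_top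
    (ENNReal.rpow_lt_top_of_nonneg (by positivity) hU))⟩

theorem isQDoubling_of_localSobolev (hX : IsQuasiMetricMeasure ρ μ) {Q s σ p β : ℝ}
    (hQ : 0 < Q) (hs : 0 < s) (hσ : 1 ≤ σ) (hp : 0 < p) (hpQ : p < Q / s) (hβ : 0 < β)
    (hreg : HasRegularDistances ρ β) {F : Set X → (X → ℝ) → ℝ≥0∞} (hF : BumpBound ρ μ s p β F)
    (h : LocalSobolev ρ μ F Q s σ p) : IsQDoubling ρ μ Q := by
  obtain ⟨K, hK, hF⟩ := hF
  obtain ⟨C, hC, h⟩ := h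
  have hsp : 0 < Q - s * p := by
    rw [lt_div_iff₀ hs, mul_comm] at hpQ
    linarith
  have hP : 0 < Q * p / (Q - s * p) := by positivity
  refine isQDoubling_of_bump_inequality (D := C * (K + 1)) hX hQ hs hp hP (by field_simp) hβ hreg
    (by positivity) fun y R L U V u hR hL hu hVU hUB _ => ?_
  have hBA : qball ρ y R ⊆ qball ρ y (σ * R) :=
    qball_subset_qball ρ y (le_mul_of_one_le_left hR.le hσ)
  have hUtop : μ U ≠ ∞ := ((measure_mono hUB).trans_lt (hX.ball_lt_top y R hR)).ne
  have hFu := hF (qball ρ y (σ * R)) U u L hL hu.measurableSet_supp hu.mem_Icc hu.eq_zero hu.holder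
  have hlow := mul_rpow_le_eLpNorm (μ := μ) hP hu.measurableSet_one.nullMeasurableSet
    (hVU.trans hUB) (f := u) zero_le_one fun x hx => by rw [hu.eq_one x hx, abs_one]
  rw [ENNReal.ofReal_one, one_mul] at hlow
  calc _ ≤ _ := hlow.trans (h y R hR u (hu.memHom hp hUtop hFu))
    _ ≤ ENNReal.ofReal C / μ (qball ρ y R) ^ (s / Q) *
        (ENNReal.ofReal (R ^ s) * (ENNReal.ofReal (K * L ^ (s / β)) * μ U ^ (1 / p)) +
          μ U ^ (1 / p)) := by
        gcongr
        exact hu.eLpNorm_le hp _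
    _ = ENNReal.ofReal C / μ (qball ρ y R) ^ (s / Q) *
        (ENNReal.ofReal (R ^ s * (K * L ^ (s / β)) + 1) * μ U ^ (1 / p)) := by
        rw [ENNReal.ofReal_add (by positivity) zero_le_one, ENNReal.ofReal_one, add_mul, one_mul,
          ENNReal.ofReal_mul (p := R ^ s) (by positivity), mul_assoc]
    _ = ENNReal.ofReal (C * (R ^ s * (K * L ^ (s / β)) + 1)) / μ (qball ρ y R) ^ (s / Q) *
        μ U ^ (1 / p) := by
        rw [ENNReal.ofReal_mul hC.le, ENNReal.mul_div_right_comm, mul_assoc]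
    _ ≤ _ := by
        gcongr ENNReal.ofReal ?_ / _ * _
        rw [mul_assoc]
        gcongr
        have : 0 ≤ R ^ s * L ^ (s / β) := by positivity
        nlinarith

theorem isQDoubling_of_localSobolevPoincare (hX : IsQuasiMetricMeasure ρ μ) {Q s σ p β : ℝ}
    (hQ : 0 < Q) (hs : 0 < s) (hσ : 1 ≤ σ) (hp : 0 < p) (hpQ : p < Q / s) (hβ : 0 < β)
    (hreg : HasRegularDistances ρ β) {F : Set X → (X → ℝ) → ℝ≥0∞} (hF : BumpBound ρ μ s p β F)
    (h : LocalSobolevPoincare ρ μ F Q s σ p) : IsQDoubling ρ μ Q := by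
  obtain ⟨K, hK, hF⟩ := hF
  obtain ⟨C, hC, h⟩ := h
  have hsp : 0 < Q - s * p := by
    rw [lt_div_iff₀ hs, mul_comm] at hpQ
    linarith
  have hP : 0 < Q * p / (Q - s * p) := by positivity
  refine isQDoubling_of_bump_inequality (D := 2 * C * K) hX hQ hs hp hP (by field_simp) hβ hreg
    (by positivity) fun y R L U V u hR hL hu hVU hUB hhalf => ?_
  have hBA : qball ρ y R ⊆ qball ρ y (σ * R) :=
    qball_subset_qball ρ y (le_mul_of_one_le_left hR.le hσ)
  have hUtop : μ U ≠ ∞ := ((measure_mono hUB).trans_lt (hX.ball_lt_top y R hR)).ne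
  have hFu := hF (qball ρ y (σ * R)) U u L hL hu.measurableSet_supp hu.mem_Icc hu.eq_zero hu.holder
  have hVW : μ V ≤ μ (qball ρ y R \ U) := by
    refine (measure_mono hVU).trans ?_
    have h1 : μ (qball ρ y R) ≤ μ (qball ρ y R \ U) + μ U :=
      (measure_mono (by simp)).trans (measure_union_le _ _)
    rw [two_mul] at hhalf
    exact (ENNReal.add_le_add_iff_right hUtop).1 (hhalf.trans h1)
  -- a constant is at distance at least `1 / 2` from `1` or from `0`
  have hlow : ∀ γ : ℝ, ENNReal.ofReal (1 / 2) * μ V ^ (1 / (Q * p / (Q - s * p))) ≤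
      eLpNorm (fun z => u z - γ) (ENNReal.ofReal (Q * p / (Q - s * p)))
        (μ.restrict (qball ρ y R)) := by
    intro γ
    rcases le_total (1 / 2) |1 - γ| with hγ | hγ
    · exact mul_rpow_le_eLpNorm hP hu.measurableSet_one.nullMeasurableSet
        (hVU.trans hUB) (by norm_num) fun x hx => by rwa [hu.eq_one x hx]
    · refine le_trans ?_ (mul_rpow_le_eLpNorm (V := qball ρ y R \ U) (b := 1 / 2) hP
        ((hX.nullMeasurableSet_ball y R hR).diff hu.measurableSet_supp.nullMeasurableSet)
        sdiff_subset (by norm_num) fun x hx => ?_)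
      · gcongr
      · rw [hu.eq_zero x hx.2, zero_sub, abs_neg]
        have := abs_le.1 hγ
        exact le_abs.2 (Or.inl (by linarith [this.2]))
  have hmain := (le_iInf hlow).trans (h y R hR u (hu.memHom hp hUtop hFu))
  calc μ V ^ (1 / (Q * p / (Q - s * p)))
      = ENNReal.ofReal 2 * (ENNReal.ofReal (1 / 2) * μ V ^ (1 / (Q * p / (Q - s * p)))) := by
        rw [← mul_assoc, ← ENNReal.ofReal_mul (by norm_num)]
        norm_num
    _ ≤ ENNReal.ofReal 2 * (ENNReal.ofReal C / μ (qball ρ y R) ^ (s / Q) *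
        (ENNReal.ofReal (R ^ s) * (ENNReal.ofReal (K * L ^ (s / β)) * μ U ^ (1 / p)))) := by
        refine mul_le_mul' le_rfl (hmain.trans ?_)
        gcongr
    _ = ENNReal.ofReal (2 * (C * (R ^ s * (K * L ^ (s / β))))) / μ (qball ρ y R) ^ (s / Q) *
        μ U ^ (1 / p) := by
        rw [ENNReal.ofReal_mul (p := 2) (by norm_num), ENNReal.ofReal_mul (p := C) hC.le,
          ENNReal.ofReal_mul (p := R ^ s) (by positivity)]
        simp only [div_eq_mul_inv]
        ring
    _ ≤ _ := by
        gcongr ENNReal.ofReal ?_ / _ * _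
        have : 0 ≤ 2 * C * K := by positivity
        linarith

/-- Here uniform perfectness enters: it provides points in `B(x, r)`, at distance comparable to `r`
from `x`, where a bump function concentrated near `x` vanishes. -/
theorem isQDoubling_of_localHolder (hX : IsQuasiMetricMeasure ρ μ) (hperf : IsUniformlyPerfect ρ)
    {Q s σ p β : ℝ} (hQ : 0 < Q) (hs : 0 < s) (hσ : 1 ≤ σ) (hpQ : Q / s < p)
    (hβ : 0 < β) (hreg : HasRegularDistances ρ β) {F : Set X → (X → ℝ) → ℝ≥0∞}
    (hF : BumpBound ρ μ s p β F) (h : LocalHolder ρ μ F Q s σ p) : IsQDoubling ρ μ Q := by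
  have hρ := hX.quasiMetric
  have hp : 0 < p := lt_trans (by positivity) hpQ
  have has : 0 < s - Q / p := by
    rw [div_lt_iff₀ hs] at hpQ
    rw [sub_pos, div_lt_iff₀ hp]
    linarith
  obtain ⟨K₀, hK₀, hF⟩ := hF
  obtain ⟨C, hC, h⟩ := h
  obtain ⟨c, hc, hreg⟩ := hreg
  obtain ⟨K, hK, hKs, hKt⟩ := hρ.exists_const
  obtain ⟨l, hl0, hl1, hperf⟩ := hperf
  have hc0 : 0 < c := by linarith
  have hK0 : 0 < K := by linarith
  set C₁ : ℝ := C * (K ^ 2) ^ (s - Q / p) * (K₀ * ((4 * c ^ 2) ^ (s / β) / (l / K) ^ s)) with hC₁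
  have hC₁0 : 0 < C₁ := by positivity
  refine ⟨min 1 (C₁ ^ p)⁻¹, by positivity, fun x y r R hr hrR hsub => ?_⟩
  have hR : 0 < R := hr.trans_le hrR
  have hMtop := (hX.ball_lt_top y R hR).ne
  suffices hmain : min 1 (C₁ ^ p)⁻¹ * (r / R) ^ Q * (μ (qball ρ y R)).toReal ≤
      (μ (qball ρ x r)).toReal by
    rw [ENNReal.le_div_iff_mul_le (Or.inl (hX.ball_pos y R hR).ne') (Or.inl hMtop),
      ← ENNReal.ofReal_toReal hMtop, ← ENNReal.ofReal_mul (by positivity)]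
    exact ENNReal.ofReal_le_of_le_toReal hmain
  have hrRQ : (r / R) ^ Q ≤ 1 :=
    Real.rpow_le_one (by positivity) ((div_le_one hR).2 hrR) hQ.le
  set r₁ : ℝ := r / K with hr₁
  have hr₁0 : 0 < r₁ := by positivity
  have hr₁r : r₁ ≤ r := div_le_self hr.le hK
  rcases (univ \ qball ρ x r₁).eq_empty_or_nonempty with hemp | hne
  · have hall : qball ρ y R ⊆ qball ρ x r := fun z _ =>
      qball_subset_qball ρ x hr₁r (sdiff_eq_empty.1 hemp (mem_univ z))
    calc _ ≤ 1 * 1 * (μ (qball ρ y R)).toReal := by gcongr; exact min_le_left _ _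
      _ ≤ _ := by
        rw [one_mul, one_mul]
        exact ENNReal.toReal_mono (hX.ball_lt_top x r hr).ne (measure_mono hall)
  obtain ⟨z, hz1, hz2⟩ := hperf x r₁ hr₁0 hne
  have hz1' : ρ x z < r₁ := hz1
  have hz2' : l * r₁ ≤ ρ x z := not_lt.1 hz2
  obtain ⟨δ, hδ1, hδ2, hδ3⟩ := hreg x
  set τ : ℝ := (l * r₁) ^ β / c with hτ
  have hτ0 : 0 < τ := by positivity
  have hτc : c * τ = (l * r₁) ^ β := by rw [hτ]; field_simp
  obtain ⟨u, hu⟩ := exists_isBump hX hc0 hβ hδ3 (by linarith : τ / 4 < τ / 2)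
  have hL : c / (τ / 2 - τ / 4) = 4 * c ^ 2 / (l * r₁) ^ β := by
    rw [hτ]
    field_simp
    norm_num
  rw [hL] at hu
  have hUx : {w | δ w < τ / 2} ⊆ qball ρ x r := by
    intro w hw
    have hw' : δ w < τ / 2 := hw
    have h1 : ρ x w ^ β < (l * r₁) ^ β := by
      calc _ ≤ c * δ w := hδ1 w
        _ < c * τ := by gcongr; linarith
        _ = _ := hτc
    have h2 := (Real.rpow_lt_rpow_iff (hρ.nonneg _ _) (by positivity) hβ).1 h1
    exact h2.trans_le ((mul_le_of_le_one_left hr₁0.le hl1.le).trans hr₁r)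
  have hUtop : μ {w | δ w < τ / 2} ≠ ∞ :=
    ((measure_mono hUx).trans_lt (hX.ball_lt_top x r hr)).ne
  have hFu := hF (qball ρ y (σ * R)) _ u _ (by positivity) hu.measurableSet_supp hu.mem_Icc
    hu.eq_zero hu.holder
  obtain ⟨v, hvu, hv⟩ := h y R hR u (hu.memHom hp hUtop hFu)
  -- in every ball inside `B(y, R)` there is a point where `v = u`
  have hpoint : ∀ w t, 0 < t → qball ρ w t ⊆ qball ρ x r → ∃ w' ∈ qball ρ w t, v w' = u w' := by
    intro w t ht hwt
    have hnull := (ae_restrict_iff'₀ (hX.nullMeasurableSet_ball y R hR)).1 hvu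
    have hpos := hX.ball_pos w t ht
    rw [← measure_sdiff_null (s := qball ρ w t) hnull] at hpos
    obtain ⟨w', hw1, hw2⟩ := nonempty_of_measure_ne_zero hpos.ne'
    refine ⟨w', hw1, ?_⟩
    have : ¬ ¬ (w' ∈ qball ρ y R → v w' = u w') := hw2
    exact not_not.1 this (hsub (hwt hw1))
  have hzr : ∀ w ∈ qball ρ z r₁, w ∈ qball ρ x r := by
    intro w hw
    have hw' : ρ z w < r₁ := hw
    calc ρ x w ≤ K * max (ρ x z) (ρ z w) := hKt _ _ _
      _ < K * r₁ := by gcongr; exact max_lt hz1' hw'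
      _ = r := by rw [hr₁]; field_simp
  obtain ⟨w₀, hw₀x, hvw₀, huw₀⟩ : ∃ w ∈ qball ρ x r, v w = u w ∧ u w = 0 := by
    have hδz : τ ≤ δ z := by
      have h1 : (l * r₁) ^ β ≤ ρ x z ^ β := Real.rpow_le_rpow (by positivity) hz2' hβ.le
      have h2 := hδ1 z
      rw [← hτc] at h1
      exact le_of_mul_le_mul_left (h1.trans h2) hc0
    obtain ⟨t, ht, hball⟩ := exists_ball_subset_of_holder hρ hc0 hβ hδ3 z (half_pos hτ0)
    have hsub' : qball ρ z (min t r₁) ⊆ qball ρ x r := fun w hw =>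
      hzr w (qball_subset_qball ρ z (min_le_right _ _) hw)
    obtain ⟨w, hw1, hw2⟩ := hpoint z (min t r₁) (by positivity) hsub'
    refine ⟨w, hsub' hw1, hw2, hu.eq_zero w ?_⟩
    have := (abs_lt.1 (hball w (qball_subset_qball ρ z (min_le_left _ _) hw1))).2
    simp only [mem_ofPred_eq, not_lt]
    linarith
  obtain ⟨w₁, hw₁x, hvw₁, huw₁⟩ : ∃ w ∈ qball ρ x r, v w = u w ∧ u w = 1 := by
    have hδx : δ x ≤ 0 := by
      have := hδ2 x
      rwa [hρ.self, Real.zero_rpow hβ.ne', mul_zero] at this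
    obtain ⟨t, ht, hball⟩ := exists_ball_subset_of_holder hρ hc0 hβ hδ3 x
      (by positivity : 0 < τ / 4)
    obtain ⟨w, hw1, hw2⟩ := hpoint x (min t r) (by positivity)
      (qball_subset_qball ρ x (min_le_right _ _))
    refine ⟨w, qball_subset_qball ρ x (min_le_right _ _) hw1, hw2, hu.eq_one w ?_⟩
    have := (abs_lt.1 (hball w (qball_subset_qball ρ x (min_le_left _ _) hw1))).1
    show δ w < τ / 4
    linarith
  have hdist : ρ w₁ w₀ ≤ K ^ 2 * r := by
    have h1 : ρ w₁ x ≤ K * r := (hKs _ _).trans (by gcongr; exact le_of_lt hw₁x)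
    have h2 : ρ x w₀ ≤ K * r := (le_of_lt hw₀x).trans (le_mul_of_one_le_left hr.le hK)
    calc _ ≤ K * max (ρ w₁ x) (ρ x w₀) := hKt _ _ _
      _ ≤ K * (K * r) := by gcongr; exact max_le h1 h2
      _ = _ := by ring
  set m := (μ (qball ρ x r)).toReal with hm
  have hm0 := hX.toReal_ball_pos x hr
  have hσR : 0 < σ * R := by nlinarith
  have hA0 := hX.toReal_ball_pos y hσR
  set A := (μ (qball ρ y (σ * R))).toReal with hA
  have hMA : (μ (qball ρ y R)).toReal ≤ A :=
    ENNReal.toReal_mono (hX.ball_lt_top y _ hσR).ne (measure_mono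
      (qball_subset_qball ρ y (le_mul_of_one_le_left hR.le hσ)))
  have hLs : (4 * c ^ 2 / (l * r₁) ^ β) ^ (s / β) =
      (4 * c ^ 2) ^ (s / β) / (l / K) ^ s / r ^ s := by
    have e : l * r₁ = l / K * r := by rw [hr₁]; ring
    rw [Real.div_rpow (by positivity) (by positivity), ← Real.rpow_mul (by positivity),
      mul_div_cancel₀ _ hβ.ne', e, Real.mul_rpow (by positivity) hr.le, div_div]
  have hFr : (F (qball ρ y (σ * R)) u).toReal ≤
      K₀ * ((4 * c ^ 2) ^ (s / β) / (l / K) ^ s / r ^ s) * m ^ (1 / p) := by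
    rw [← hLs]
    have h1 : F (qball ρ y (σ * R)) u ≤
        ENNReal.ofReal (K₀ * (4 * c ^ 2 / (l * r₁) ^ β) ^ (s / β)) *
          μ (qball ρ x r) ^ (1 / p) := hFu.trans (by gcongr)
    have h2 := ENNReal.toReal_mono (ENNReal.mul_ne_top ENNReal.ofReal_ne_top
      (ENNReal.rpow_ne_top_of_nonneg (by positivity) (hX.ball_lt_top x r hr).ne)) h1
    rwa [ENNReal.toReal_mul, ENNReal.toReal_ofReal (by positivity), ← ENNReal.toReal_rpow] at h2
  have hone : 1 ≤ C₁ * (R / r) ^ (Q / p) * (m ^ (1 / p) / A ^ (1 / p)) := by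
    have h1 := hv w₁ (hsub hw₁x) w₀ (hsub hw₀x)
    rw [hvw₁, hvw₀, huw₁, huw₀, sub_zero, abs_one] at h1
    have h2 : ρ w₁ w₀ ^ (s - Q / p) ≤ (K ^ 2) ^ (s - Q / p) * r ^ (s - Q / p) := by
      rw [← Real.mul_rpow (by positivity) hr.le]
      exact Real.rpow_le_rpow (hρ.nonneg _ _) hdist has.le
    calc (1 : ℝ) ≤ _ := h1
      _ ≤ C * ((K ^ 2) ^ (s - Q / p) * r ^ (s - Q / p)) * (R ^ (Q / p) / A ^ (1 / p)) *
          (K₀ * ((4 * c ^ 2) ^ (s / β) / (l / K) ^ s / r ^ s) * m ^ (1 / p)) := by gcongr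
      _ = _ := by
        rw [hC₁, Real.rpow_sub hr, Real.div_rpow hR.le hr.le]
        field_simp
  have hApow : A ≤ C₁ ^ p * (R / r) ^ Q * m := by
    have h1 : A ^ (1 / p) ≤ C₁ * (R / r) ^ (Q / p) * m ^ (1 / p) := by
      rw [mul_div_assoc', le_div_iff₀ (by positivity), one_mul] at hone
      exact hone
    have h2 := Real.rpow_le_rpow (by positivity) h1 hp.le
    rw [← Real.rpow_mul hA0.le, one_div_mul_cancel hp.ne', Real.rpow_one,
      Real.mul_rpow (by positivity) (by positivity), Real.mul_rpow (by positivity)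
      (by positivity), ← Real.rpow_mul (by positivity), ← Real.rpow_mul hm0.le,
      one_div_mul_cancel hp.ne', Real.rpow_one, div_mul_cancel₀ _ hp.ne'] at h2
    exact h2
  have hinv : (R / r) ^ Q * (r / R) ^ Q = 1 := by
    rw [← Real.mul_rpow (by positivity) (by positivity)]
    have : R / r * (r / R) = 1 := by field_simp
    rw [this, Real.one_rpow]
  calc _ ≤ (C₁ ^ p)⁻¹ * (r / R) ^ Q * (C₁ ^ p * (R / r) ^ Q * m) := by
        gcongr
        · exact min_le_right _ _
        · exact hMA.trans hApow
    _ = (C₁ ^ p)⁻¹ * C₁ ^ p * ((R / r) ^ Q * (r / R) ^ Q) * m := by ring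
    _ = m := by
        rw [hinv, inv_mul_cancel₀ (by positivity)]
        ring

end

end QuasiMetricSobolev

open QuasiMetricSobolev in
theorem theorem1p2 {X : Type*} [Nontrivial X] [MeasurableSpace X] (ρ : X → X → ℝ) (μ : Measure X)
    (hX : IsQuasiMetricMeasure ρ μ) (hperf : IsUniformlyPerfect ρ)
    (q : ℝ≥0∞) (hq : 0 < q) (Q : ℝ) (hQ : 0 < Q) (σ : ℝ) (hσ : triConst ρ ≤ σ)
    (s : ℝ) (hs : 0 < s) (hind : IndexLE ρ s q) :
    -- the spaces `Ṁ^s_{p,q}`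
    [ IsQDoubling ρ μ Q,
      ∃ p : ℝ, 0 < p ∧ p < Q / s ∧ LocalSobolev ρ μ (normM ρ μ s p q) Q s σ p,
      ∃ p : ℝ, 0 < p ∧ p < Q / s ∧ LocalSobolevPoincare ρ μ (normM ρ μ s p q) Q s σ p,
      ∃ p : ℝ, Q / s < p ∧ LocalHolder ρ μ (normM ρ μ s p q) Q s σ p ].TFAE ∧
    -- the spaces `Ṅ^s_{p,q}` with `q ≤ p`, when there are such `p` in `(0, Q / s)`
    (q < ENNReal.ofReal (Q / s) →
      [ IsQDoubling ρ μ Q,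
        ∃ p : ℝ, 0 < p ∧ p < Q / s ∧ q ≤ ENNReal.ofReal p ∧
          LocalSobolev ρ μ (normN ρ μ s p q) Q s σ p,
        ∃ p : ℝ, 0 < p ∧ p < Q / s ∧ q ≤ ENNReal.ofReal p ∧
          LocalSobolevPoincare ρ μ (normN ρ μ s p q) Q s σ p,
        ∃ p : ℝ, Q / s < p ∧ q ≤ ENNReal.ofReal p ∧
          LocalHolder ρ μ (normN ρ μ s p q) Q s σ p ].TFAE) ∧
    -- the Hölder estimate for `Ṅ^s_{p,q}` with `q ≤ p`, for every finite `q`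
    (q < ∞ →
      (IsQDoubling ρ μ Q ↔
        ∃ p : ℝ, Q / s < p ∧ q ≤ ENNReal.ofReal p ∧
          LocalHolder ρ μ (normN ρ μ s p q) Q s σ p)) := by
  have hρ := hX.quasiMetric
  have hσ1 : 1 ≤ σ := hρ.one_le_triConst.trans hσ
  have hQs : 0 < Q / s := by positivity
  obtain ⟨β, hsβ, hqβ, hreg⟩ := hind.exists_hasRegularDistances hρ hs
  have hβ : 0 < β := hs.trans_le hsβ
  have hholderN : q < ∞ → IsQDoubling ρ μ Q → ∃ p : ℝ, Q / s < p ∧ q ≤ ENNReal.ofReal p ∧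
      LocalHolder ρ μ (normN ρ μ s p q) Q s σ p := fun hqt hd => by
    have hp : Q / s < max (Q / s) q.toReal + 1 := by linarith [le_max_left (Q / s) q.toReal]
    have hqp : q ≤ ENNReal.ofReal (max (Q / s) q.toReal + 1) := by
      rw [ENNReal.le_ofReal_iff_toReal_le hqt.ne (by positivity)]
      linarith [le_max_right (Q / s) q.toReal]
    exact ⟨_, hp, hqp, localHolder_of_isQDoubling hX hQ hσ hd hs hp
      (dominatesHajlasz_normN hρ (hQs.trans hp) hq hqp)⟩
  have hholderN' : (∃ p : ℝ, Q / s < p ∧ q ≤ ENNReal.ofReal p ∧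
      LocalHolder ρ μ (normN ρ μ s p q) Q s σ p) → IsQDoubling ρ μ Q := by
    rintro ⟨p, hp, -, h⟩
    exact isQDoubling_of_localHolder hX hperf hQ hs hσ1 hp hβ hreg
      (bumpBound_normN hs (hQs.trans hp) hsβ hq hqβ) h
  refine ⟨?_, fun hqQ => ?_, fun hqt => ⟨hholderN hqt, hholderN'⟩⟩
  · tfae_have 1 → 2 := fun hd =>
      ⟨Q / s / 2, by positivity, half_lt_self hQs, localSobolev_of_isQDoubling hX hQ hσ hd hs
        (by positivity) (half_lt_self hQs) (dominatesHajlasz_normM hρ (by positivity) hq)⟩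
    tfae_have 1 → 3 := fun hd =>
      ⟨Q / s / 2, by positivity, half_lt_self hQs, localSobolevPoincare_of_isQDoubling hX hQ hσ hd
        hs (by positivity) (half_lt_self hQs) (dominatesHajlasz_normM hρ (by positivity) hq)⟩
    tfae_have 1 → 4 := fun hd =>
      ⟨Q / s + 1, by linarith, localHolder_of_isQDoubling hX hQ hσ hd hs (by linarith)
        (dominatesHajlasz_normM hρ (by positivity) hq)⟩
    tfae_have 2 → 1 := fun ⟨p, hp, hpQ, h⟩ =>
      isQDoubling_of_localSobolev hX hQ hs hσ1 hp hpQ hβ hreg (bumpBound_normM hs hp hsβ hq hqβ) h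
    tfae_have 3 → 1 := fun ⟨p, hp, hpQ, h⟩ =>
      isQDoubling_of_localSobolevPoincare hX hQ hs hσ1 hp hpQ hβ hreg
        (bumpBound_normM hs hp hsβ hq hqβ) h
    tfae_have 4 → 1 := fun ⟨p, hp, h⟩ =>
      isQDoubling_of_localHolder hX hperf hQ hs hσ1 hp hβ hreg
        (bumpBound_normM hs (hQs.trans hp) hsβ hq hqβ) h
    tfae_finish
  · have hqt : q < ∞ := hqQ.trans_le le_top
    have hqr : q.toReal < Q / s := (ENNReal.lt_ofReal_iff_toReal_lt hqt.ne).1 hqQ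
    obtain ⟨p, hqp, hpQ⟩ := exists_between hqr
    have hp : 0 < p := (ENNReal.toReal_pos hq.ne' hqt.ne).trans hqp
    have hqp' : q ≤ ENNReal.ofReal p := (ENNReal.le_ofReal_iff_toReal_le hqt.ne hp.le).2 hqp.le
    have hdom := dominatesHajlasz_normN (μ := μ) hρ (s := s) hp hq hqp'
    tfae_have 1 → 2 := fun hd =>
      ⟨p, hp, hpQ, hqp', localSobolev_of_isQDoubling hX hQ hσ hd hs hp hpQ hdom⟩
    tfae_have 1 → 3 := fun hd =>
      ⟨p, hp, hpQ, hqp', localSobolevPoincare_of_isQDoubling hX hQ hσ hd hs hp hpQ hdom⟩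
    tfae_have 1 → 4 := hholderN hqt
    tfae_have 2 → 1 := fun ⟨p, hp, hpQ, _, h⟩ =>
      isQDoubling_of_localSobolev hX hQ hs hσ1 hp hpQ hβ hreg (bumpBound_normN hs hp hsβ hq hqβ) h
    tfae_have 3 → 1 := fun ⟨p, hp, hpQ, _, h⟩ =>
      isQDoubling_of_localSobolevPoincare hX hQ hs hσ1 hp hpQ hβ hreg
        (bumpBound_normN hs hp hsβ hq hqβ) h
    tfae_have 4 → 1 := hholderN'
    tfae_finish
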